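/- **Setting.** Fix $m\ge 0$. An instance consists of a finite universe $\mathcal U$ of $n$ points, a pseudometric $d:\mathcal U\times\mathcal U\to\mathbb R_{\ge 0}$, possibly overlapping classes $\mathcal U_1,\dots,\mathcal U_m\subseteq\mathcal U$, and integers $0\le k_i\le|\mathcal U_i|$. A set $S\subseteq\mathcal U$ is *feasible* if $|S\cap\mathcal U_i|\ge k_i$ for all $i$. Let $\mathrm{div}(S)=\min\{d(u,v):u,v\in S,\ u\ne v\}$ (with $\min\emptyset=+\infty$), and let $\ell^*=\max\{\mathrm{div}(S): S \text{ feasible}\}$. For $L\subseteq[m]$ let $X_L$ be the set of points that lie in the classes $\mathcal U_i$, $i\in L$, and in no others. Let $M=\binom{m}{\lfloor m/2\rfloor}$. **The algorithm Fair$^+$-Flow.** The input is an instance, a guess $\gamma\in\mathbb R$, and guesses $c_L\in\mathbb Z_{\ge 0}$ for all non-empty $L\subseteq[m]$. Put $d_1=\frac{M\gamma}{3M-1}$ and $d_2=\frac{\gamma}{3M-1}$. 1. For all non-empty $L\subseteq[m]$, in order of decreasing size, let $Z_L$ be a maximal subset of $X_L$ such that every point of $Z_L$ has distance at least $d_1$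 from every other point of $Z_L\cup\bigcup_{L'\supsetneq L}Z_{L'}$. 2. Let $C_1,\dots,C_t$ be the connected components of the graph on $Z=\bigcup_L Z_L$ in which distinct points at distance $<d_2$ are adjacent. 3. Compute a maximum integral $a$–$b$ flow in the network with nodes $a$, $u_L$ ($\emptyset\neq L\subseteq[m]$), $v_1,\dots,v_t$, $b$ and with edges $(a,u_L)$ of capacity $c_L$, $(v_j,b)$ of capacity $1$, and $(u_L,v_j)$ of capacity $1$ for certain pairs $(L,j)$. Two rules for these pairs are considered: (E) $Z_L\cap C_j\ne\emptyset$; (S) $Z_{L'}\cap C_j\neq\emptyset$ for some $L'\supseteq L$. 4. If the size of the flow is less than $\sum_L c_L$, abort. Otherwise return a set that consists of one point of $C_j\cap\bigcap_{i\in L}\mathcal U_i$ for every edge $(u_L,v_j)$ that carries flow. Call the guess $c$ *admissible* if $\sum_{L\ni i}c_L\ge k_i$ for all $i\in[m]$. **Theorem.** For each of the two rules the following holds. (a) For all $\gamma$ and $c$ the algorithm can be carried out. If $c$ is admissible then for every $\gamma\in\mathbb R$ (in particular for $\gamma>\ell^*$), and whatever choices are made in steps 1, 3 and 4, the algorithm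 aborts or returns a feasible set whose points are pairwise at least $\frac{\gamma}{3M-1}$ apart. (b) Let $\gamma\le\ell^*$. Then for every choice of the sets $Z_L$ there is an admissible guess $c$ for which the algorithm, whatever the remaining choices, returns a feasible set whose points are pairwise at least $\frac{\gamma}{3M-1}$ apart. Under rule (S), the algorithm returns such a set, whatever choices are made, for every guess of the form $c_L=|O\cap X_L|$ with $O$ an optimal solution. (c) For the fixed number $m$ of classes, there is an algorithm that, on every instance with $n$ points, runs in time polynomial in $n$ and outputs a feasible set $S$ with $\mathrm{div}(S)\ge\frac{1}{3M-1}\,\ell^*$; moreover $S$ is a set that Fair$^+$-Flow may return for some $\gamma$ and some admissible $c$. Here time is the number of steps of a uniform random access machine with natural and real registers that has read access to $n$, the $k_i$, the class memberships and the distances, whose operations are addition, subtraction, comparison and indirect addressing at unit cost, and whose only constants are natural numbers. -/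

import Mathlib

namespace FairDiv

/-! ### The problem -/

/-- An instance with `m` possibly overlapping classes over a universe of `n` points:
a pseudometric, the classes and the fairness constraints `k i ≤ |U i|`. -/
structure Instance (m n : ℕ) where
  d : Fin n → Fin n → ℝ
  d_nonneg : ∀ x y, 0 ≤ d x y
  d_self : ∀ x, d x x = 0
  d_symm : ∀ x y, d x y = d y x
  d_triangle : ∀ x y z, d x z ≤ d x y + d y z
  U : Fin m → Finset (Fin n)
  k : Fin m → ℕ
  k_le : ∀ i, k i ≤ (U i).card

/-- The number `M = C(m, ⌊m/2⌋)`. -/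
def bigM (m : ℕ) : ℕ := m.choose (m / 2)

/-- Colours: the non-empty sets of classes. -/
abbrev Colour (m : ℕ) := {L : Finset (Fin m) // L.Nonempty}

section
variable {m n : ℕ} (I : Instance m n)

/-- `S` contains at least `k i` points of every class. -/
def Feasible (S : Finset (Fin n)) : Prop := ∀ i, I.k i ≤ (S ∩ I.U i).card

/-- The minimum distance of two distinct points of `S`
(`⊤` if there are no two distinct points, as a minimum over the empty set). -/
noncomputable def diversity (S : Finset (Fin n)) : EReal :=
  ⨅ (x ∈ S) (y ∈ S) (_ : x ≠ y), (I.d x y : EReal)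

/-- The optimum fair diversity. -/
noncomputable def opt : EReal := ⨆ (S : Finset (Fin n)) (_ : Feasible I S), diversity I S

def IsOptimal (O : Finset (Fin n)) : Prop := Feasible I O ∧ diversity I O = opt I

/-- All points of `S` are at least `r` apart. -/
def Apart (r : ℝ) (S : Finset (Fin n)) : Prop := ∀ x ∈ S, ∀ y ∈ S, x ≠ y → r ≤ I.d x y

/-- `X_L`: the points that lie in the classes of `L` and in no others. -/
def X (L : Finset (Fin m)) : Finset (Fin n) :=
  Finset.univ.filter fun x => ∀ i, x ∈ I.U i ↔ i ∈ L

/-- The colour counts `|O ∩ X_L|` of a set `O`. -/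
def counts (O : Finset (Fin n)) (L : Colour m) : ℕ := (O ∩ X I L.1).card

/-- A guess of the counts that is consistent with the fairness constraints. -/
def Admissible (c : Colour m → ℕ) : Prop :=
  ∀ i, I.k i ≤ ∑ L ∈ Finset.univ.filter (fun L : Colour m => i ∈ L.1), c L

end

/-! ### Integral flows -/

structure Network (V : Type) where
  cap : V → V → ℕ
  source : V
  sink : V

namespace Network
variable {V : Type} [Fintype V] (N : Network V)

/-- Integral flows: capacity constraints, and conservation at the inner nodes. -/
def IsFlow (f : V → V → ℕ) : Prop :=
  (∀ u v, f u v ≤ N.cap u v) ∧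
    ∀ v, v ≠ N.source → v ≠ N.sink → ∑ u, f u v = ∑ w, f v w

/-- The net amount that leaves the source. -/
def value (f : V → V → ℕ) : ℤ := ∑ v, (f N.source v : ℤ) - ∑ v, (f v N.source : ℤ)

def IsMaxFlow (f : V → V → ℕ) : Prop :=
  N.IsFlow f ∧ ∀ g, N.IsFlow g → N.value g ≤ N.value f

end Network

/-! ### The algorithm Fair⁺-Flow -/

section
variable {m n : ℕ} (I : Instance m n) (γ : ℝ)

noncomputable def d1 (m : ℕ) (γ : ℝ) : ℝ := bigM m * γ / (3 * bigM m - 1)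

noncomputable def d2 (m : ℕ) (γ : ℝ) : ℝ := γ / (3 * bigM m - 1)

/-- A possible result of the selection phase: every `Z L` is a maximal subset of `X_L` whose
points are at least `d1` from every other point of `Z L` and of the sets `Z L'`, `L ⊂ L'`.
(The condition on `Z L` involves only the sets `Z L'` chosen in earlier rounds.) -/
def IsSelection (Z : Colour m → Finset (Fin n)) : Prop :=
  ∀ L : Colour m, Maximal
    (fun A : Finset (Fin n) => A ⊆ X I L.1 ∧
      ∀ x ∈ A, ∀ y, (y ∈ A ∨ ∃ L' : Colour m, L.1 ⊂ L'.1 ∧ y ∈ Z L') →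
        x ≠ y → d1 m γ ≤ I.d x y)
    (Z L)

/-- The selected points. -/
abbrev Selected (Z : Colour m → Finset (Fin n)) := {x : Fin n // ∃ L, x ∈ Z L}

/-- The graph `G_Z`: selected points are joined if they are less than `d2` apart. -/
def closeGraph (Z : Colour m → Finset (Fin n)) : SimpleGraph (Selected Z) where
  Adj x y := x ≠ y ∧ I.d x.1 y.1 < d2 m γ
  symm := ⟨fun x y h => ⟨h.1.symm, by rw [I.d_symm]; exact h.2⟩⟩
  loopless := ⟨fun _ h => h.1 rfl⟩

abbrev Comp (Z : Colour m → Finset (Fin n)) := (closeGraph I γ Z).ConnectedComponent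

noncomputable instance (Z : Colour m → Finset (Fin n)) : Fintype (Comp I γ Z) :=
  Fintype.ofFinite _

/-- When is a point of `Z_{L'}` in the component `C_j` a reason for an edge `(u_L, v_j)`?
`exact`: if `L' = L`; `atLeast`: if `L ⊆ L'`, that is, if it lies in all classes of `L`. -/
inductive EdgeRule
  | exact
  | atLeast

def EdgeRule.Allows : EdgeRule → Colour m → Colour m → Prop
  | .exact, L, L' => L' = L
  | .atLeast, L, L' => L.1 ⊆ L'.1

/-- The nodes of the flow network: `a`, the `u_L`, the `v_j`, and `b`. -/
abbrev Node (Z : Colour m → Finset (Fin n)) := Unit ⊕ Colour m ⊕ Comp I γ Z ⊕ Unit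

abbrev nodeA (Z : Colour m → Finset (Fin n)) : Node I γ Z := .inl ()
abbrev nodeU (Z : Colour m → Finset (Fin n)) (L : Colour m) : Node I γ Z := .inr (.inl L)
abbrev nodeV (Z : Colour m → Finset (Fin n)) (j : Comp I γ Z) : Node I γ Z :=
  .inr (.inr (.inl j))
abbrev nodeB (Z : Colour m → Finset (Fin n)) : Node I γ Z := .inr (.inr (.inr ()))

/-- The component `j` gives rise to an edge from `u_L`. -/
def HasEdge (R : EdgeRule) (Z : Colour m → Finset (Fin n)) (L : Colour m) (j : Comp I γ Z) :
    Prop :=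
  ∃ x : Selected Z, (closeGraph I γ Z).connectedComponentMk x = j ∧
    ∃ L' : Colour m, R.Allows L L' ∧ x.1 ∈ Z L'

open Classical in
noncomputable def flowNetwork (R : EdgeRule) (c : Colour m → ℕ)
    (Z : Colour m → Finset (Fin n)) : Network (Node I γ Z) where
  cap
    | .inl _, .inr (.inl L) => c L
    | .inr (.inl L), .inr (.inr (.inl j)) => if HasEdge I γ R Z L j then 1 else 0
    | .inr (.inr (.inl _)), .inr (.inr (.inr _)) => 1
    | _, _ => 0
  source := nodeA I γ Z
  sink := nodeB I γ Z

/-- `Outcome I γ R c Z r`: with selection `Z` and guesses `γ`, `c`, the flow phase may end with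
the result `r`, where `none` means that it aborts. A maximum flow is computed; if its size is less
than `∑ L, c L`, the algorithm aborts; otherwise it returns the set `S` that contains, for every
edge `(u_L, v_j)` with flow, one point of `C_j` that lies in all the classes of `L`. -/
def Outcome (R : EdgeRule) (c : Colour m → ℕ) (Z : Colour m → Finset (Fin n)) :
    Option (Finset (Fin n)) → Prop
  | none => ∃ f, (flowNetwork I γ R c Z).IsMaxFlow f ∧
      (flowNetwork I γ R c Z).value f < ∑ L, (c L : ℤ)
  | some S => ∃ f, (flowNetwork I γ R c Z).IsMaxFlow f ∧
      ∑ L, (c L : ℤ) ≤ (flowNetwork I γ R c Z).value f ∧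
      ∃ pick : Colour m → Comp I γ Z → Fin n,
        (∀ L j, 0 < f (nodeU I γ Z L) (nodeV I γ Z j) →
          (∃ x : Selected Z, x.1 = pick L j ∧ (closeGraph I γ Z).connectedComponentMk x = j) ∧
          ∀ i ∈ L.1, pick L j ∈ I.U i) ∧
        ∀ x, x ∈ S ↔ ∃ L j, 0 < f (nodeU I γ Z L) (nodeV I γ Z j) ∧ pick L j = x

/-- `r` is a possible result of Fair⁺-Flow on the guesses `γ`, `c`. -/
def FairPlusFlow (R : EdgeRule) (c : Colour m → ℕ) (r : Option (Finset (Fin n))) : Prop :=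
  ∃ Z, IsSelection I γ Z ∧ Outcome I γ R c Z r

end

/-! ### The machine model

A random access machine over the naturals and the reals, programmed in a while-language. It has
arrays of naturals and arrays of reals, and read access to the input. Its only
arithmetical operations are addition and subtraction (truncated on `ℕ`), its only constants
are naturals, and reals are inspected only by comparing them. Every operation costs one step.
-/

/-- Natural-valued expressions. -/
inductive NatExp
  | lit (c : ℕ)
  /-- the number `n` of points -/
  | size
  /-- the fairness constraint `k_i` -/
  | quota (i : NatExp)
  /-- `1` if the point `x` is in the class `U_i`, and `0` otherwise -/
  | member (x i : NatExp)
  /-- the entry with index `i` of the natural array `a` -/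
  | get (a : ℕ) (i : NatExp)
  | add (e f : NatExp)
  | sub (e f : NatExp)

/-- Real-valued expressions. -/
inductive RealExp
  | lit (c : ℕ)
  /-- the distance of two points -/
  | dist (x y : NatExp)
  /-- the entry with index `i` of the real array `a` -/
  | get (a : ℕ) (i : NatExp)
  | add (e f : RealExp)
  | sub (e f : RealExp)

inductive Test
  | natLe (e f : NatExp)
  | realLe (e f : RealExp)
  | not (t : Test)

inductive Program
  | skip
  /-- array `a` of naturals, entry `i`, receives the value of `e` -/
  | setNat (a : ℕ) (i e : NatExp)
  /-- array `a` of reals, entry `i`, receives the value of `e` -/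
  | setReal (a : ℕ) (i : NatExp) (e : RealExp)
  | seq (p q : Program)
  | ite (t : Test) (p q : Program)
  | loop (t : Test) (p : Program)

/-- The contents of the memory. -/
structure Memory where
  nat : ℕ → ℕ → ℕ
  real : ℕ → ℕ → ℝ

def Memory.setNat (s : Memory) (a i v : ℕ) : Memory :=
  ⟨Function.update s.nat a (Function.update (s.nat a) i v), s.real⟩

def Memory.setReal (s : Memory) (a i : ℕ) (v : ℝ) : Memory :=
  ⟨s.nat, Function.update s.real a (Function.update (s.real a) i v)⟩

def Memory.init : Memory := ⟨fun _ _ => 0, fun _ _ => 0⟩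

def NatExp.cost : NatExp → ℕ
  | .lit _ => 1
  | .size => 1
  | .quota i => i.cost + 1
  | .member x i => x.cost + i.cost + 1
  | .get _ i => i.cost + 1
  | .add e f => e.cost + f.cost + 1
  | .sub e f => e.cost + f.cost + 1

def RealExp.cost : RealExp → ℕ
  | .lit _ => 1
  | .dist x y => x.cost + y.cost + 1
  | .get _ i => i.cost + 1
  | .add e f => e.cost + f.cost + 1
  | .sub e f => e.cost + f.cost + 1

def Test.cost : Test → ℕ
  | .natLe e f => e.cost + f.cost + 1
  | .realLe e f => e.cost + f.cost + 1
  | .not t => t.cost + 1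

section
variable {m n : ℕ} (I : Instance m n)

def NatExp.eval (s : Memory) : NatExp → ℕ
  | .lit c => c
  | .size => n
  | .quota i => if h : i.eval s < m then I.k ⟨i.eval s, h⟩ else 0
  | .member x i =>
      if h : x.eval s < n ∧ i.eval s < m then
        if (⟨x.eval s, h.1⟩ : Fin n) ∈ I.U ⟨i.eval s, h.2⟩ then 1 else 0
      else 0
  | .get a i => s.nat a (i.eval s)
  | .add e f => e.eval s + f.eval s
  | .sub e f => e.eval s - f.eval s

noncomputable def RealExp.eval (s : Memory) : RealExp → ℝ
  | .lit c => c
  | .dist x y =>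
      if h : x.eval I s < n ∧ y.eval I s < n then
        I.d ⟨x.eval I s, h.1⟩ ⟨y.eval I s, h.2⟩
      else 0
  | .get a i => s.real a (i.eval I s)
  | .add e f => e.eval s + f.eval s
  | .sub e f => e.eval s - f.eval s

def Test.Holds (s : Memory) : Test → Prop
  | .natLe e f => e.eval I s ≤ f.eval I s
  | .realLe e f => e.eval I s ≤ f.eval I s
  | .not t => ¬ t.Holds s

/-- `Exec I p s t s'`: on the input `I`, started in `s`, the program `p` halts after exactly `t`
steps in `s'`. -/
inductive Exec : Program → Memory → ℕ → Memory → Prop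
  | skip (s) : Exec .skip s 1 s
  | setNat (s a i e) : Exec (.setNat a i e) s (i.cost + e.cost + 1)
      (s.setNat a (i.eval I s) (e.eval I s))
  | setReal (s a i e) : Exec (.setReal a i e) s (i.cost + e.cost + 1)
      (s.setReal a (i.eval I s) (e.eval I s))
  | seq {p q s t₁ s₁ t₂ s₂} : Exec p s t₁ s₁ → Exec q s₁ t₂ s₂ →
      Exec (.seq p q) s (t₁ + t₂) s₂
  | ite_true {b p q s t s'} : b.Holds I s → Exec p s t s' →
      Exec (.ite b p q) s (b.cost + t) s'
  | ite_false {b p q s t s'} : ¬ b.Holds I s → Exec q s t s' →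
      Exec (.ite b p q) s (b.cost + t) s'
  | loop_stop {b p s} : ¬ b.Holds I s → Exec (.loop b p) s b.cost s
  | loop_step {b p s t₁ s₁ t₂ s₂} : b.Holds I s → Exec p s t₁ s₁ →
      Exec (.loop b p) s₁ t₂ s₂ → Exec (.loop b p) s (b.cost + t₁ + t₂) s₂

end

/-- The set that a halted program outputs: its characteristic function is in array `0`. -/
def output (n : ℕ) (s : Memory) : Finset (Fin n) :=
  Finset.univ.filter fun x => s.nat 0 x.1 ≠ 0

/-- On input `I` the program outputs `S` after at most `T` steps. -/
def Computes {m n : ℕ} (I : Instance m n) (p : Program) (T : ℕ) (S : Finset (Fin n)) : Prop :=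
  ∃ t s, Exec I p Memory.init t s ∧ t ≤ T ∧ output n s = S

end FairDiv

/-!
By Sperner's theorem more than `M` points on a path in `G_Z` include two with comparable colours,
which are then less than `M * d2 = d1` apart; the selection rule excludes this. So the components
have diameter at most `(M - 1) * d2`, and since every point is less than `d1` from a selected point
whose classes include its own, the points of an optimal solution move to different components. This
gives the flow of full value.

For the running time the guesses for `c` need not be enumerated: a result of the flow phase is a
set of selected points with at most one point in every component, and whether it is feasible depends
only on the numbers of its points in the classes. These numbers are the digits of one number below
`(n + 1) ^ m`, and a table over these numbers holds one such set for every number that occurs. The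
guesses for `γ` are the distances and one number that is large enough if the optimum is infinite.
-/

namespace FairDiv

/-! ### Greedy selections -/

section
variable {m n : ℕ}

theorem bigM_pos (m : ℕ) : 0 < bigM m := Nat.choose_pos (Nat.div_le_self _ _)

theorem one_le_bigM_cast (m : ℕ) : (1 : ℝ) ≤ bigM m := by exact_mod_cast bigM_pos m

theorem denominator_pos (m : ℕ) : (0 : ℝ) < 3 * bigM m - 1 := by
  have := one_le_bigM_cast m
  linarith

theorem d1_eq (m : ℕ) (γ : ℝ) : d1 m γ = bigM m * d2 m γ := by
  unfold d1 d2
  ring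

theorem gamma_eq (m : ℕ) (γ : ℝ) : γ = (3 * bigM m - 1) * d2 m γ := by
  unfold d2
  field_simp [(denominator_pos m).ne']

variable (I : Instance m n) (γ r : ℝ)

/-- The colour of the point `x`, that is, the set of the classes that contain it. -/
def colourOf (x : Fin n) : Finset (Fin m) := Finset.univ.filter fun i => x ∈ I.U i

/-- Some point of `A` whose colour contains that of `x` is less than `r` from `x`. -/
def Blocked (A : Finset (Fin n)) (x : Fin n) : Prop :=
  ∃ y ∈ A, colourOf I x ⊆ colourOf I y ∧ I.d x y < r

/-- `A` is a possible state of the greedy selection after the points of `D` have been considered: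
points of comparable colours in `A` are at least `r` apart, and the other points of `D` are
blocked. -/
structure IsGreedy (D A : Finset (Fin n)) : Prop where
  subset : A ⊆ D
  le_dist : ∀ x ∈ A, ∀ y ∈ A, x ≠ y → colourOf I x ⊆ colourOf I y → r ≤ I.d x y
  blocked : ∀ x ∈ D, x ∉ A → Blocked I r A x

variable {I γ r} {D A : Finset (Fin n)} {Z : Colour m → Finset (Fin n)}

theorem mem_colourOf {x : Fin n} {i : Fin m} : i ∈ colourOf I x ↔ x ∈ I.U i := by
  simp [colourOf]

theorem mem_X_iff {x : Fin n} {L : Finset (Fin m)} : x ∈ X I L ↔ colourOf I x = L := by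
  simp [X, Finset.ext_iff, mem_colourOf]

theorem IsGreedy.empty : IsGreedy I r ∅ ∅ := ⟨subset_rfl, by simp, by simp⟩

theorem IsGreedy.insert_of_blocked (h : IsGreedy I r D A) {x : Fin n} (hx : Blocked I r A x) :
    IsGreedy I r (insert x D) A where
  subset := h.subset.trans (Finset.subset_insert x D)
  le_dist := h.le_dist
  blocked z hz hzA := by
    rcases Finset.mem_insert.1 hz with rfl | hz
    · exact hx
    · exact h.blocked z hz hzA

/-- As the colour of `x` is not larger than the earlier colours, the points of `A` whose colours
are contained in that of `x` have the same colour as `x`. -/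
theorem IsGreedy.insert_of_not_blocked (h : IsGreedy I r D A) {x : Fin n}
    (hcard : ∀ y ∈ D, (colourOf I x).card ≤ (colourOf I y).card) (hx : ¬ Blocked I r A x) :
    IsGreedy I r (insert x D) (insert x A) where
  subset := Finset.insert_subset_insert x h.subset
  le_dist := by
    have hfar : ∀ y ∈ A, colourOf I x ⊆ colourOf I y → r ≤ I.d x y := fun y hy hsub =>
      not_lt.1 fun hlt => hx ⟨y, hy, hsub, hlt⟩
    intro y hy z hz hne hsub
    rcases Finset.mem_insert.1 hy with rfl | hyA <;> rcases Finset.mem_insert.1 hz with rfl | hzA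
    · exact absurd rfl hne
    · exact hfar z hzA hsub
    · rw [I.d_symm]
      exact hfar y hyA (Finset.eq_of_subset_of_card_le hsub (hcard y (h.subset hyA))).superset
    · exact h.le_dist y hyA z hzA hne hsub
  blocked z hz hzA := by
    rw [Finset.mem_insert, not_or] at hzA
    obtain ⟨y, hy, hblock⟩ := h.blocked z ((Finset.mem_insert.1 hz).resolve_left hzA.1) hzA.2
    exact ⟨y, Finset.mem_insert_of_mem hy, hblock⟩

theorem exists_isGreedy (I : Instance m n) (r : ℝ) (D : Finset (Fin n)) :
    ∃ A, IsGreedy I r D A := by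
  classical
  induction D using Finset.induction_on_min_value fun x => (colourOf I x).card with
  | empty => exact ⟨∅, .empty⟩
  | insert x D _ hcard ih =>
    obtain ⟨A, hA⟩ := ih
    by_cases hx : Blocked I r A x
    · exact ⟨A, hA.insert_of_blocked hx⟩
    · exact ⟨insert x A, hA.insert_of_not_blocked hcard hx⟩

/-- The points of `A`, split by their colours. -/
def colourClasses (I : Instance m n) (A : Finset (Fin n)) (L : Colour m) : Finset (Fin n) :=
  A.filter fun x => colourOf I x = L.1

theorem mem_colourClasses {x : Fin n} {L : Colour m} :
    x ∈ colourClasses I A L ↔ x ∈ A ∧ colourOf I x = L.1 := by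
  simp [colourClasses]

theorem IsGreedy.isSelection (h : IsGreedy I (d1 m γ) D A)
    (hD : ∀ x, (colourOf I x).Nonempty → x ∈ D) : IsSelection I γ (colourClasses I A) := by
  refine fun L => ⟨⟨fun x hx => mem_X_iff.2 (mem_colourClasses.1 hx).2, ?_⟩, ?_⟩
  · rintro x hx y hy hne
    obtain ⟨hxA, hxL⟩ := mem_colourClasses.1 hx
    rcases hy with hy | ⟨L', hL', hy⟩ <;> obtain ⟨hyA, hyL⟩ := mem_colourClasses.1 hy
    · exact h.le_dist x hxA y hyA hne (by rw [hxL, hyL])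
    · exact h.le_dist x hxA y hyA hne (by rw [hxL, hyL]; exact hL'.subset)
  · rintro B ⟨hBX, hB⟩ hle x hx
    have hxL := mem_X_iff.1 (hBX hx)
    refine mem_colourClasses.2 ⟨?_, hxL⟩
    by_contra hxA
    obtain ⟨y, hyA, hsub, hlt⟩ := h.blocked x (hD x (hxL ▸ L.2)) hxA
    refine absurd (hB x hx y ?_ fun h => hxA (h ▸ hyA)) (not_le.2 hlt)
    rw [hxL] at hsub
    rcases hsub.eq_or_ssubset with heq | hssub
    · exact Or.inl (hle (mem_colourClasses.2 ⟨hyA, heq.symm⟩))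
    · exact Or.inr ⟨⟨colourOf I y, L.2.mono hsub⟩, hssub, mem_colourClasses.2 ⟨hyA, rfl⟩⟩

theorem exists_isSelection (I : Instance m n) (γ : ℝ) : ∃ Z, IsSelection I γ Z := by
  obtain ⟨A, hA⟩ := exists_isGreedy I (d1 m γ) Finset.univ
  exact ⟨_, hA.isSelection fun x _ => Finset.mem_univ x⟩

theorem IsSelection.colourOf_eq (hZ : IsSelection I γ Z) {L : Colour m} {x : Fin n}
    (hx : x ∈ Z L) : colourOf I x = L.1 :=
  mem_X_iff.1 ((hZ L).1.1 hx)

theorem IsSelection.le_dist (hZ : IsSelection I γ Z) {L L' : Colour m} {x y : Fin n}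
    (hx : x ∈ Z L) (hy : y ∈ Z L') (hL : L.1 ⊆ L'.1) (hxy : x ≠ y) : d1 m γ ≤ I.d x y := by
  refine (hZ L).1.2 x hx y ?_ hxy
  rcases hL.eq_or_ssubset with h | h
  · exact Or.inl (Subtype.ext h ▸ hy)
  · exact Or.inr ⟨L', h, hy⟩

theorem IsSelection.exists_close (hZ : IsSelection I γ Z) {L : Colour m} {x : Fin n}
    (hx : colourOf I x = L.1) :
    ∃ (L' : Colour m) (y : Fin n), L.1 ⊆ L'.1 ∧ y ∈ Z L' ∧ (x = y ∨ I.d x y < d1 m γ) := by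
  by_contra! hcon
  have hxZ : x ∉ Z L := fun h => (hcon L x subset_rfl h).1 rfl
  have hfar : ∀ y, (y ∈ Z L ∨ ∃ L' : Colour m, L.1 ⊂ L'.1 ∧ y ∈ Z L') → d1 m γ ≤ I.d x y := by
    rintro y (h | ⟨L', h, hy⟩)
    · exact (hcon L y subset_rfl h).2
    · exact (hcon L' y h.subset hy).2
  refine hxZ ((hZ L).2 (y := insert x (Z L)) ⟨?_, ?_⟩ (Finset.subset_insert _ _)
    (Finset.mem_insert_self _ _))
  · exact Finset.insert_subset (mem_X_iff.2 hx) (hZ L).1.1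
  · intro a ha b hb hab
    rcases Finset.mem_insert.1 ha with rfl | haZ
    · exact hfar b (hb.imp_left fun h => (Finset.mem_insert.1 h).resolve_left hab.symm)
    · rcases hb with hb | hb
      · rcases Finset.mem_insert.1 hb with rfl | hb
        · rw [I.d_symm]
          exact hfar a (Or.inl haZ)
        · exact (hZ L).1.2 a haZ b (Or.inl hb) hab
      · exact (hZ L).1.2 a haZ b (Or.inr hb) hab

end

/-! ### Components of the graph of close points -/

/-- Sperner's theorem for indexed families. -/
theorem exists_ne_subset_of_choose_lt_card {ι α : Type*} [Fintype ι] [Fintype α]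
    (c : ι → Finset α)
    (h : (Fintype.card α).choose (Fintype.card α / 2) < Fintype.card ι) :
    ∃ i j, i ≠ j ∧ c i ⊆ c j := by
  classical
  by_contra! hcon
  have hinj : Function.Injective c := fun i j hij => by
    by_contra hne
    exact hcon i j hne hij.subset
  have hanti : IsAntichain (· ⊆ ·) (SetLike.coe (Finset.univ.image c)) := by
    rintro _ ha _ hb hab hsub
    obtain ⟨i, -, rfl⟩ := Finset.mem_image.1 (Finset.mem_coe.1 ha)
    obtain ⟨j, -, rfl⟩ := Finset.mem_image.1 (Finset.mem_coe.1 hb)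
    exact hcon i j (fun hij => hab (congrArg c hij)) hsub
  have hle := hanti.sperner
  rw [Finset.card_image_of_injective _ hinj, Finset.card_univ] at hle
  exact absurd h (not_lt.2 hle)

section
variable {m n : ℕ} {I : Instance m n} {γ : ℝ} {Z : Colour m → Finset (Fin n)}

theorem dist_getVert_lt {u v : Selected Z} (p : (closeGraph I γ Z).Walk u v) {i j : ℕ}
    (hij : i < j) (hj : j ≤ p.length) :
    I.d (p.getVert i).1 (p.getVert j).1 < ((j : ℝ) - i) * d2 m γ := by
  induction j, hij using Nat.le_induction with
  | base =>
    have hadj := (p.adj_getVert_succ (i := i) (by lia)).2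
    push_cast
    linarith
  | succ k _ ih =>
    have hadj := (p.adj_getVert_succ (i := k) (by lia)).2
    have hlt := ih (by lia)
    have htri := I.d_triangle (p.getVert i).1 (p.getVert k).1 (p.getVert (k + 1)).1
    push_cast
    linarith

theorem dist_getVert_lt_d1 {u v : Selected Z} (p : (closeGraph I γ Z).Walk u v) {i j : ℕ}
    (hij : i ≠ j) (hi : i ≤ p.length) (hj : j ≤ p.length) (hiM : i ≤ bigM m)
    (hjM : j ≤ bigM m) : I.d (p.getVert i).1 (p.getVert j).1 < d1 m γ := by
  wlog hlt : i < j generalizing i j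
  · rw [I.d_symm]
    exact this hij.symm hj hi hjM hiM (by lia)
  have hdist := dist_getVert_lt p hlt hj
  have hpos : (0 : ℝ) < j - i := sub_pos.2 (by exact_mod_cast hlt)
  have hd2 : 0 < d2 m γ := pos_of_mul_pos_right ((I.d_nonneg _ _).trans_lt hdist) hpos.le
  have hsteps : (j : ℝ) - i ≤ bigM m := (sub_le_self _ i.cast_nonneg).trans (by exact_mod_cast hjM)
  rw [d1_eq]
  exact hdist.trans_le (mul_le_mul_of_nonneg_right hsteps hd2.le)

/-- If a path had more than `M` points, two of its first `M + 1` points would have comparable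
colours by Sperner's theorem, but be less than `M * d2 = d1` apart. -/
theorem IsSelection.length_lt (hZ : IsSelection I γ Z) {u v : Selected Z}
    (p : (closeGraph I γ Z).Walk u v) (hp : p.IsPath) : p.length < bigM m := by
  by_contra! hlen
  choose col hcol using fun x : Selected Z => x.2
  obtain ⟨i, j, hij, hsub⟩ := exists_ne_subset_of_choose_lt_card
    (fun i : Fin (bigM m + 1) => (col (p.getVert i)).1)
    (by simp only [Fintype.card_fin]; exact Nat.lt_succ_self _)
  have hi : (i : ℕ) ≤ p.length := by lia
  have hj : (j : ℕ) ≤ p.length := by lia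
  have hne : p.getVert i ≠ p.getVert j := fun h => hij (Fin.ext (hp.getVert_injOn hi hj h))
  refine absurd (hZ.le_dist (hcol _) (hcol _) hsub fun h => hne (Subtype.ext h)) (not_le.2 ?_)
  exact dist_getVert_lt_d1 p (fun h => hij (Fin.ext h)) hi hj (by lia) (by lia)

theorem IsSelection.dist_of_reachable (hZ : IsSelection I γ Z) {u v : Selected Z}
    (h : (closeGraph I γ Z).Reachable u v) :
    u = v ∨ (0 < d2 m γ ∧ I.d u.1 v.1 ≤ (bigM m - 1) * d2 m γ) := by
  obtain ⟨p, hp⟩ := h.exists_isPath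
  rcases Nat.eq_zero_or_pos p.length with h0 | h0
  · exact Or.inl (SimpleGraph.Walk.eq_of_length_eq_zero h0)
  · have hdist := dist_getVert_lt p h0 le_rfl
    rw [p.getVert_zero, p.getVert_length, Nat.cast_zero, sub_zero] at hdist
    have hd2 : 0 < d2 m γ :=
      pos_of_mul_pos_right ((I.d_nonneg _ _).trans_lt hdist) (Nat.cast_nonneg _)
    have hlen : (p.length : ℝ) ≤ bigM m - 1 :=
      le_sub_iff_add_le.2 (by exact_mod_cast hZ.length_lt p hp)
    exact Or.inr ⟨hd2, hdist.le.trans (mul_le_mul_of_nonneg_right hlen hd2.le)⟩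

/-- Two distances below `d1 = M * d2` and one of at most `(M - 1) * d2` add up to less than
`γ = (3 * M - 1) * d2`. -/
theorem IsSelection.eq_of_reachable (hZ : IsSelection I γ Z) {x x' : Fin n} {y y' : Selected Z}
    (hx : x = y.1 ∨ I.d x y.1 < d1 m γ) (hx' : x' = y'.1 ∨ I.d x' y'.1 < d1 m γ)
    (hfar : x ≠ x' → γ ≤ I.d x x') (h : (closeGraph I γ Z).Reachable y y') : x = x' := by
  by_contra hne
  have hγ : (3 * bigM m - 1) * d2 m γ ≤ I.d x x' := gamma_eq m γ ▸ hfar hne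
  have hM := one_le_bigM_cast m
  rw [d1_eq] at hx hx'
  rcases le_or_gt (d2 m γ) 0 with hd2 | hd2
  · have hnlt : ∀ a b, ¬ I.d a b < bigM m * d2 m γ := fun a b =>
      not_lt.2 ((mul_nonpos_of_nonneg_of_nonpos (by linarith) hd2).trans (I.d_nonneg a b))
    obtain rfl : y = y' := (hZ.dist_of_reachable h).resolve_right fun h => absurd h.1 hd2.not_gt
    exact hne ((hx.resolve_right (hnlt _ _)).trans (hx'.resolve_right (hnlt _ _)).symm)
  · have hlt : ∀ {a b}, (a = b ∨ I.d a b < bigM m * d2 m γ) → I.d a b < bigM m * d2 m γ := by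
      rintro a b (rfl | h)
      · rw [I.d_self]
        positivity
      · exact h
    have hyy' : I.d y.1 y'.1 ≤ (bigM m - 1) * d2 m γ := by
      rcases hZ.dist_of_reachable h with rfl | h
      · rw [I.d_self]
        exact mul_nonneg (by linarith) hd2.le
      · exact h.2
    have htri := I.d_triangle x y.1 x'
    have htri' := I.d_triangle y.1 y'.1 x'
    rw [I.d_symm y'.1 x'] at htri'
    linarith [hlt hx, hlt hx']

end

/-! ### Flows -/

theorem Network.exists_isMaxFlow {V : Type} [Fintype V] (N : Network V) :
    ∃ f, N.IsMaxFlow f := by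
  classical
  have hfin : {f | N.IsFlow f}.Finite :=
    (Set.finite_Icc (0 : V → V → ℕ) N.cap).subset fun f hf =>
      ⟨fun _ _ => Nat.zero_le _, fun u v => hf.1 u v⟩
  exact Set.exists_max_image _ N.value hfin
    ⟨fun _ _ => 0, fun _ _ => Nat.zero_le _, fun _ _ _ => by simp⟩

theorem Network.IsFlow.eq_zero {V : Type} [Fintype V] {N : Network V} {f : V → V → ℕ}
    (hf : N.IsFlow f) {u v : V} (h : N.cap u v = 0) : f u v = 0 :=
  Nat.le_zero.1 (h ▸ hf.1 u v)

section
variable {m n : ℕ} {I : Instance m n} {γ : ℝ} {R : EdgeRule} {c : Colour m → ℕ}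
  {Z : Colour m → Finset (Fin n)} {f : Node I γ Z → Node I γ Z → ℕ}

theorem value_eq_sum_flow_source (hf : (flowNetwork I γ R c Z).IsFlow f) :
    (flowNetwork I γ R c Z).value f = ∑ L, (f (nodeA I γ Z) (nodeU I γ Z L) : ℤ) := by
  have hin : ∀ v, f v (nodeA I γ Z) = 0 := fun v => hf.eq_zero (by
    rcases v with _ | _ | _ | _ <;> rfl)
  have hV : ∀ j, f (nodeA I γ Z) (nodeV I γ Z j) = 0 := fun j => hf.eq_zero rfl
  have hB : f (nodeA I γ Z) (nodeB I γ Z) = 0 := hf.eq_zero rfl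
  simp only [Network.value]
  rw [show (flowNetwork I γ R c Z).source = nodeA I γ Z from rfl]
  simp [Fintype.sum_sum_type, hin, hV, hB]

theorem flow_source_le (hf : (flowNetwork I γ R c Z).IsFlow f) (L : Colour m) :
    f (nodeA I γ Z) (nodeU I γ Z L) ≤ c L := hf.1 _ _

theorem value_le (hf : (flowNetwork I γ R c Z).IsFlow f) :
    (flowNetwork I γ R c Z).value f ≤ ∑ L, (c L : ℤ) := by
  rw [value_eq_sum_flow_source hf]
  exact Finset.sum_le_sum fun L _ => Nat.cast_le.2 (flow_source_le hf L)

theorem flow_source_eq (hf : (flowNetwork I γ R c Z).IsFlow f)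
    (hval : ∑ L, (c L : ℤ) ≤ (flowNetwork I γ R c Z).value f) (L : Colour m) :
    f (nodeA I γ Z) (nodeU I γ Z L) = c L := by
  have hle : ∀ L ∈ Finset.univ, (f (nodeA I γ Z) (nodeU I γ Z L) : ℤ) ≤ c L := fun L _ =>
    Nat.cast_le.2 (flow_source_le hf L)
  rw [value_eq_sum_flow_source hf] at hval
  exact_mod_cast (Finset.sum_eq_sum_iff_of_le hle).1 ((Finset.sum_le_sum hle).antisymm hval) L
    (Finset.mem_univ L)

theorem sum_flow_colour (hf : (flowNetwork I γ R c Z).IsFlow f) (L : Colour m) :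
    ∑ j, f (nodeU I γ Z L) (nodeV I γ Z j) = f (nodeA I γ Z) (nodeU I γ Z L) := by
  have hcons := hf.2 (nodeU I γ Z L) (by simp [flowNetwork]) (by simp [flowNetwork])
  have hUU : ∀ L₁ L₂, f (nodeU I γ Z L₁) (nodeU I γ Z L₂) = 0 := fun _ _ => hf.eq_zero rfl
  have hVU : ∀ j, f (nodeV I γ Z j) (nodeU I γ Z L) = 0 := fun _ => hf.eq_zero rfl
  have hBU : f (nodeB I γ Z) (nodeU I γ Z L) = 0 := hf.eq_zero rfl
  have hUA : f (nodeU I γ Z L) (nodeA I γ Z) = 0 := hf.eq_zero rfl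
  have hUB : f (nodeU I γ Z L) (nodeB I γ Z) = 0 := hf.eq_zero rfl
  simpa [Fintype.sum_sum_type, hUU, hVU, hBU, hUA, hUB] using hcons.symm

theorem sum_flow_comp_le_one (hf : (flowNetwork I γ R c Z).IsFlow f) (j : Comp I γ Z) :
    ∑ L, f (nodeU I γ Z L) (nodeV I γ Z j) ≤ 1 := by
  have hcons := hf.2 (nodeV I γ Z j) (by simp [flowNetwork]) (by simp [flowNetwork])
  have hAV : f (nodeA I γ Z) (nodeV I γ Z j) = 0 := hf.eq_zero rfl
  have hVV : ∀ j₁ j₂, f (nodeV I γ Z j₁) (nodeV I γ Z j₂) = 0 := fun _ _ => hf.eq_zero rfl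
  have hBV : f (nodeB I γ Z) (nodeV I γ Z j) = 0 := hf.eq_zero rfl
  have hVA : f (nodeV I γ Z j) (nodeA I γ Z) = 0 := hf.eq_zero rfl
  have hVU : ∀ L, f (nodeV I γ Z j) (nodeU I γ Z L) = 0 := fun _ => hf.eq_zero rfl
  have hsum : ∑ L, f (nodeU I γ Z L) (nodeV I γ Z j) = f (nodeV I γ Z j) (nodeB I γ Z) := by
    simpa [Fintype.sum_sum_type, hAV, hVV, hBV, hVA, hVU] using hcons
  exact hsum.trans_le (hf.1 (nodeV I γ Z j) (nodeB I γ Z))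

theorem flow_le_one (hf : (flowNetwork I γ R c Z).IsFlow f) (L : Colour m) (j : Comp I γ Z) :
    f (nodeU I γ Z L) (nodeV I γ Z j) ≤ 1 :=
  (Finset.single_le_sum (f := fun L => f (nodeU I γ Z L) (nodeV I γ Z j))
    (fun _ _ => Nat.zero_le _) (Finset.mem_univ L)).trans (sum_flow_comp_le_one hf j)

theorem hasEdge_of_flow_pos (hf : (flowNetwork I γ R c Z).IsFlow f) {L : Colour m}
    {j : Comp I γ Z} (h : 0 < f (nodeU I γ Z L) (nodeV I γ Z j)) : HasEdge I γ R Z L j := by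
  by_contra hcon
  exact h.ne' (hf.eq_zero (by simp [flowNetwork, hcon]))

theorem colour_unique (hf : (flowNetwork I γ R c Z).IsFlow f) {L L' : Colour m}
    {j : Comp I γ Z} (h : 0 < f (nodeU I γ Z L) (nodeV I γ Z j))
    (h' : 0 < f (nodeU I γ Z L') (nodeV I γ Z j)) : L = L' := by
  by_contra hne
  have hpair := Finset.sum_le_univ_sum_of_nonneg
    (f := fun L => f (nodeU I γ Z L) (nodeV I γ Z j)) (s := {L, L'}) fun _ => Nat.zero_le _
  rw [Finset.sum_pair hne] at hpair
  have := sum_flow_comp_le_one hf j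
  lia

theorem edge_unique (hf : (flowNetwork I γ R c Z).IsFlow f) {L L' : Colour m}
    {x x' : Selected Z}
    (h : 0 < f (nodeU I γ Z L) (nodeV I γ Z ((closeGraph I γ Z).connectedComponentMk x)))
    (h' : 0 < f (nodeU I γ Z L') (nodeV I γ Z ((closeGraph I γ Z).connectedComponentMk x')))
    (hx : (closeGraph I γ Z).Reachable x x') :
    L = L' ∧ (closeGraph I γ Z).connectedComponentMk x =
      (closeGraph I γ Z).connectedComponentMk x' := by
  have hj := SimpleGraph.ConnectedComponent.eq.2 hx
  exact ⟨colour_unique hf (hj ▸ h) h', hj⟩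

open Classical in
theorem card_flow_edges (hf : (flowNetwork I γ R c Z).IsFlow f)
    (hval : ∑ L, (c L : ℤ) ≤ (flowNetwork I γ R c Z).value f) (L : Colour m) :
    (Finset.univ.filter fun j => 0 < f (nodeU I γ Z L) (nodeV I γ Z j)).card = c L := by
  rw [← flow_source_eq hf hval L, ← sum_flow_colour hf L, Finset.card_filter]
  refine Finset.sum_congr rfl fun j _ => ?_
  have := flow_le_one hf L j
  split_ifs <;> lia

theorem feasible_of_outcome {S : Finset (Fin n)} (hc : Admissible I c)
    (h : Outcome I γ R c Z (some S)) : Feasible I S := by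
  classical
  obtain ⟨f, ⟨hf, -⟩, hval, pick, hpick, hS⟩ := h
  intro i
  refine (hc i).trans ?_
  simp_rw [← card_flow_edges hf hval]
  rw [← Finset.card_sigma]
  refine Finset.card_le_card_of_injOn (fun e => pick e.1 e.2) ?_ ?_
  · rintro ⟨L, j⟩ he
    simp only [Finset.coe_sigma, Set.mem_sigma_iff, Finset.mem_coe, Finset.mem_filter,
      Finset.mem_univ, true_and] at he
    exact Finset.mem_inter.2 ⟨(hS _).2 ⟨L, j, he.2, rfl⟩, (hpick L j he.2).2 i he.1⟩
  · rintro ⟨L, j⟩ he ⟨L', j'⟩ he' heq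
    simp only [Finset.coe_sigma, Set.mem_sigma_iff, Finset.mem_coe, Finset.mem_filter,
      Finset.mem_univ, true_and] at he he' heq
    obtain ⟨x, hx, rfl⟩ := (hpick L j he.2).1
    obtain ⟨x', hx', rfl⟩ := (hpick L' j' he'.2).1
    obtain rfl : x = x' := Subtype.ext (by rw [hx, hx', heq])
    rw [(edge_unique hf he.2 he'.2 .rfl).1]

theorem apart_of_outcome {S : Finset (Fin n)} (h : Outcome I γ R c Z (some S)) :
    Apart I (d2 m γ) S := by
  obtain ⟨f, ⟨hf, -⟩, -, pick, hpick, hS⟩ := h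
  intro x hx y hy hxy
  obtain ⟨L, j, hpos, rfl⟩ := (hS x).1 hx
  obtain ⟨L', j', hpos', rfl⟩ := (hS y).1 hy
  obtain ⟨u, hu, rfl⟩ := (hpick L j hpos).1
  obtain ⟨v, hv, rfl⟩ := (hpick L' j' hpos').1
  by_contra! hlt
  have hadj : (closeGraph I γ Z).Adj u v :=
    ⟨fun huv => hxy (by rw [← hu, ← hv, huv]), by rwa [hu, hv]⟩
  obtain ⟨hL, hj⟩ := edge_unique hf hpos hpos' hadj.reachable
  exact hxy (by rw [hL, hj])

theorem exists_point_of_hasEdge (hZ : IsSelection I γ Z) {L : Colour m} {j : Comp I γ Z}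
    (h : HasEdge I γ R Z L j) :
    ∃ x : Selected Z, (closeGraph I γ Z).connectedComponentMk x = j ∧ ∀ i ∈ L.1, x.1 ∈ I.U i := by
  obtain ⟨x, hj, L', hL', hx⟩ := h
  refine ⟨x, hj, fun i hi => ?_⟩
  rw [← mem_colourOf, hZ.colourOf_eq hx]
  cases R with
  | exact => exact (show L' = L from hL') ▸ hi
  | atLeast => exact hL' hi

theorem exists_outcome (hZ : IsSelection I γ Z) (R : EdgeRule) (c : Colour m → ℕ) :
    ∃ r, Outcome I γ R c Z r := by
  classical
  obtain ⟨f, hf⟩ := (flowNetwork I γ R c Z).exists_isMaxFlow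
  rcases lt_or_ge ((flowNetwork I γ R c Z).value f) (∑ L, (c L : ℤ)) with hval | hval
  · exact ⟨none, f, hf, hval⟩
  · have hpoint : ∀ L j, ∃ x : Selected Z, 0 < f (nodeU I γ Z L) (nodeV I γ Z j) →
        (closeGraph I γ Z).connectedComponentMk x = j ∧ ∀ i ∈ L.1, x.1 ∈ I.U i := by
      intro L j
      by_cases hpos : 0 < f (nodeU I γ Z L) (nodeV I γ Z j)
      · obtain ⟨x, hx⟩ := exists_point_of_hasEdge hZ (hasEdge_of_flow_pos hf.1 hpos)
        exact ⟨x, fun _ => hx⟩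
      · exact ⟨j.exists_rep.choose, fun h => absurd h hpos⟩
    choose pick hpick using hpoint
    refine ⟨some (Finset.univ.filter fun x => ∃ L j,
      0 < f (nodeU I γ Z L) (nodeV I γ Z j) ∧ (pick L j).1 = x), f, hf, hval,
      fun L j => (pick L j).1, fun L j hpos => ?_, fun x => by simp⟩
    exact ⟨⟨pick L j, rfl, (hpick L j hpos).1⟩, (hpick L j hpos).2⟩

/-! ### Assignments of colours to components -/

open Classical in
/-- The flow that sends one unit through `u_(g i)` and `v_(h i)` for every index `i`. -/
noncomputable def assignFlow {ι : Type*} [Fintype ι] (g : ι → Colour m) (h : ι → Comp I γ Z) :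
    Node I γ Z → Node I γ Z → ℕ
  | .inl _, .inr (.inl L) => (Finset.univ.filter fun i => g i = L).card
  | .inr (.inl L), .inr (.inr (.inl j)) => (Finset.univ.filter fun i => g i = L ∧ h i = j).card
  | .inr (.inr (.inl j)), .inr (.inr (.inr _)) => (Finset.univ.filter fun i => h i = j).card
  | _, _ => 0

open Classical in
/-- The guess `c` under which the colour of every index is counted. -/
noncomputable def colourCount {ι : Type*} [Fintype ι] (g : ι → Colour m) (L : Colour m) : ℕ :=
  (Finset.univ.filter fun i => g i = L).card

variable {ι : Type*} [Fintype ι] {g : ι → Colour m} {h : ι → Comp I γ Z}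

theorem assignFlow_pos_iff {L : Colour m} {j : Comp I γ Z} :
    0 < assignFlow g h (nodeU I γ Z L) (nodeV I γ Z j) ↔ ∃ i, g i = L ∧ h i = j := by
  simp only [assignFlow, Finset.card_pos, Finset.filter_nonempty_iff, Finset.mem_univ, true_and]

theorem assignFlow_le_cap (hinj : Function.Injective h)
    (hedge : ∀ i, HasEdge I γ R Z (g i) (h i)) (u v : Node I γ Z) :
    assignFlow g h u v ≤ (flowNetwork I γ R (colourCount g) Z).cap u v := by
  classical
  have hle : ∀ j : Comp I γ Z, (Finset.univ.filter fun i => h i = j).card ≤ 1 := fun j =>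
    Finset.card_le_one.2 fun a ha b hb =>
      hinj ((Finset.mem_filter.1 ha).2.trans (Finset.mem_filter.1 hb).2.symm)
  rcases u with _ | L | j | _ <;> rcases v with _ | L' | j' | _ <;>
    simp only [assignFlow, flowNetwork, le_refl, colourCount]
  · split_ifs with hE
    · exact (Finset.card_le_card (Finset.monotone_filter_right _ fun i _ hi => hi.2)).trans (hle j')
    · rw [Nat.le_zero, Finset.card_eq_zero, Finset.filter_eq_empty_iff]
      rintro i - ⟨rfl, rfl⟩
      exact hE (hedge i)
  · exact hle j

theorem assignFlow_conserved (v : Node I γ Z) (hA : v ≠ nodeA I γ Z) (hB : v ≠ nodeB I γ Z) :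
    ∑ u, assignFlow g h u v = ∑ w, assignFlow g h v w := by
  classical
  rcases v with _ | L | j | _
  · exact absurd rfl hA
  · simp only [Fintype.sum_sum_type, assignFlow, Finset.sum_const_zero, Finset.univ_unique,
      Finset.sum_singleton, add_zero, zero_add]
    rw [Finset.card_eq_sum_card_fiberwise (f := h)
      (s := Finset.univ.filter fun i => g i = L) (t := Finset.univ) fun _ _ => by simp]
    simp only [Finset.filter_filter]
  · simp only [Fintype.sum_sum_type, assignFlow, Finset.sum_const_zero, Finset.univ_unique,
      Finset.sum_singleton, add_zero, zero_add]
    rw [Finset.card_eq_sum_card_fiberwise (f := g)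
      (s := Finset.univ.filter fun i => h i = j) (t := Finset.univ) fun _ _ => by simp]
    simp only [Finset.filter_filter, and_comm]
  · exact absurd rfl hB

theorem isFlow_assignFlow (hinj : Function.Injective h)
    (hedge : ∀ i, HasEdge I γ R Z (g i) (h i)) :
    (flowNetwork I γ R (colourCount g) Z).IsFlow (assignFlow g h) :=
  ⟨assignFlow_le_cap hinj hedge, assignFlow_conserved⟩

theorem value_assignFlow (hinj : Function.Injective h)
    (hedge : ∀ i, HasEdge I γ R Z (g i) (h i)) :
    (flowNetwork I γ R (colourCount g) Z).value (assignFlow g h) =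
      ∑ L, (colourCount g L : ℤ) := by
  rw [value_eq_sum_flow_source (isFlow_assignFlow hinj hedge)]
  rfl

theorem isMaxFlow_assignFlow (hinj : Function.Injective h)
    (hedge : ∀ i, HasEdge I γ R Z (g i) (h i)) :
    (flowNetwork I γ R (colourCount g) Z).IsMaxFlow (assignFlow g h) :=
  ⟨isFlow_assignFlow hinj hedge, fun _ hf => value_assignFlow hinj hedge ▸ value_le hf⟩

theorem returns_of_assignment (hinj : Function.Injective h)
    (hedge : ∀ i, HasEdge I γ R Z (g i) (h i)) (hadm : Admissible I (colourCount g))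
    {r : Option (Finset (Fin n))} (hr : Outcome I γ R (colourCount g) Z r) :
    ∃ S, r = some S ∧ Feasible I S ∧ Apart I (d2 m γ) S := by
  rcases r with _ | S
  · obtain ⟨f, hf, hlt⟩ := hr
    exact absurd (hf.2 _ (isFlow_assignFlow hinj hedge))
      (by rw [value_assignFlow hinj hedge]; exact not_le.2 hlt)
  · exact ⟨S, rfl, feasible_of_outcome hadm hr, apart_of_outcome hr⟩

theorem outcome_image (hZ : IsSelection I γ Z) {y : ι → Selected Z}
    (hinj : Function.Injective fun i => (closeGraph I γ Z).connectedComponentMk (y i))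
    (hy : ∀ i, (y i).1 ∈ Z (g i)) (R : EdgeRule) :
    Outcome I γ R (colourCount g) Z (some (Finset.univ.image fun i => (y i).1)) := by
  set h : ι → Comp I γ Z := fun i => (closeGraph I γ Z).connectedComponentMk (y i)
  have hedge : ∀ i, HasEdge I γ R Z (g i) (h i) := fun i =>
    ⟨y i, rfl, g i, by cases R <;> simp [EdgeRule.Allows], hy i⟩
  choose rep _ using fun j : Comp I γ Z => j.exists_rep
  set pick : Comp I γ Z → Fin n := Function.extend h (fun i => (y i).1) fun j => (rep j).1
  have hpick : ∀ i, pick (h i) = (y i).1 := hinj.extend_apply _ _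
  refine ⟨assignFlow g h, isMaxFlow_assignFlow hinj hedge, (value_assignFlow hinj hedge).ge,
    fun _ j => pick j, fun L j hpos => ?_, fun x => ?_⟩
  · obtain ⟨i, rfl, rfl⟩ := assignFlow_pos_iff.1 hpos
    refine ⟨⟨y i, (hpick i).symm, rfl⟩, fun k hk => ?_⟩
    change pick (h i) ∈ I.U k
    rwa [hpick, ← mem_colourOf, hZ.colourOf_eq (hy i)]
  · simp only [assignFlow_pos_iff, Finset.mem_image, Finset.mem_univ, true_and]
    constructor
    · rintro ⟨i, rfl⟩
      exact ⟨g i, h i, ⟨i, rfl, rfl⟩, hpick i⟩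
    · rintro ⟨L, j, ⟨i, rfl, rfl⟩, rfl⟩
      exact ⟨i, (hpick i).symm⟩

theorem sum_colourCount (g : ι → Colour m) (i : Fin m) :
    ∑ L ∈ Finset.univ.filter (fun L : Colour m => i ∈ L.1), colourCount g L =
      (Finset.univ.filter fun x => i ∈ (g x).1).card := by
  classical
  rw [Finset.card_eq_sum_card_fiberwise (f := g) (s := Finset.univ.filter fun x => i ∈ (g x).1)
    (t := Finset.univ.filter (fun L : Colour m => i ∈ L.1)) (fun x hx => by simpa using hx)]
  refine Finset.sum_congr rfl fun L hL => ?_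
  rw [colourCount, Finset.filter_filter]
  congr 1
  ext x
  simp only [Finset.mem_filter, Finset.mem_univ, true_and] at hL ⊢
  exact ⟨fun h => ⟨h ▸ hL, h⟩, fun h => h.2⟩

end

section
variable {m n : ℕ} {I : Instance m n} {γ : ℝ} {Z : Colour m → Finset (Fin n)}
  {O T : Finset (Fin n)}

/-- The points of `O` that lie in some class. -/
abbrev Coloured (I : Instance m n) (O : Finset (Fin n)) :=
  {x : Fin n // x ∈ O ∧ (colourOf I x).Nonempty}

theorem card_inter_class_le {g : Coloured I O → Colour m}
    (hg : ∀ x, colourOf I x.1 ⊆ (g x).1) (i : Fin m) :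
    (O ∩ I.U i).card ≤ (Finset.univ.filter fun x => i ∈ (g x).1).card := by
  refine Finset.card_le_card_of_surjOn (fun x => x.1) fun x hx => ?_
  rw [Finset.mem_coe, Finset.mem_inter, ← mem_colourOf] at hx
  refine ⟨⟨x, hx.1, i, hx.2⟩, ?_, rfl⟩
  simpa using hg ⟨x, hx.1, i, hx.2⟩ hx.2

theorem admissible_colourCount (hO : Feasible I O) {g : Coloured I O → Colour m}
    (hg : ∀ x, colourOf I x.1 ⊆ (g x).1) : Admissible I (colourCount g) := by
  intro i
  rw [sum_colourCount]
  exact (hO i).trans (card_inter_class_le hg i)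

theorem counts_eq_colourCount (O : Finset (Fin n)) :
    counts I O = colourCount fun x : Coloured I O => ⟨colourOf I x.1, x.2.2⟩ := by
  classical
  funext L
  symm
  refine Finset.card_bij (fun x _ => x.1) ?_ (fun x _ y _ h => Subtype.ext h) ?_
  · intro x hx
    rw [Finset.mem_inter, mem_X_iff]
    exact ⟨x.2.1, congrArg Subtype.val (Finset.mem_filter.1 hx).2⟩
  · intro x hx
    rw [Finset.mem_inter, mem_X_iff] at hx
    exact ⟨⟨x, hx.1, hx.2 ▸ L.2⟩, by simpa [Subtype.ext_iff] using hx.2, rfl⟩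

theorem IsSelection.exists_move (hZ : IsSelection I γ Z) (hO : Apart I γ O) :
    ∃ (g : Coloured I O → Colour m) (y : Coloured I O → Selected Z),
      (∀ x, colourOf I x.1 ⊆ (g x).1) ∧ (∀ x, (y x).1 ∈ Z (g x)) ∧
      Function.Injective fun x => (closeGraph I γ Z).connectedComponentMk (y x) := by
  choose g y hsub hy hclose using fun x : Coloured I O =>
    hZ.exists_close (L := ⟨colourOf I x.1, x.2.2⟩) (x := x.1) rfl
  refine ⟨g, fun x => ⟨y x, g x, hy x⟩, hsub, hy, fun x x' h => Subtype.ext ?_⟩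
  exact hZ.eq_of_reachable (y := ⟨y x, g x, hy x⟩) (y' := ⟨y x', g x', hy x'⟩) (hclose x)
    (hclose x') (hO x.1 x.2.1 x'.1 x'.2.1) (SimpleGraph.ConnectedComponent.eq.1 h)

theorem le_diversity_iff {r : ℝ} : (r : EReal) ≤ diversity I O ↔ Apart I r O := by
  simp only [diversity, le_iInf_iff, EReal.coe_le_coe_iff, Apart]

theorem exists_isOptimal (I : Instance m n) : ∃ O, IsOptimal I O := by
  have huniv : Feasible I Finset.univ := fun i => by
    rw [Finset.univ_inter]
    exact I.k_le i
  obtain ⟨O, hO, hmax⟩ := Set.exists_max_image {S | Feasible I S} (diversity I)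
    (Set.toFinite _) ⟨_, huniv⟩
  exact ⟨O, hO, le_antisymm (le_iSup₂ (f := fun S _ => diversity I S) O hO)
    (iSup₂_le fun S hS => hmax S hS)⟩

theorem IsOptimal.apart (hO : IsOptimal I O) (hγ : (γ : EReal) ≤ opt I) : Apart I γ O :=
  le_diversity_iff.1 (hO.2 ▸ hγ)

theorem exists_admissible_returns (R : EdgeRule) (hγ : (γ : EReal) ≤ opt I)
    (hZ : IsSelection I γ Z) :
    ∃ c : Colour m → ℕ, Admissible I c ∧ ∀ r, Outcome I γ R c Z r →
      ∃ S, r = some S ∧ Feasible I S ∧ Apart I (d2 m γ) S := by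
  obtain ⟨O, hO⟩ := exists_isOptimal I
  obtain ⟨g, y, hsub, hy, hinj⟩ := hZ.exists_move (hO.apart hγ)
  have hadm := admissible_colourCount hO.1 hsub
  refine ⟨_, hadm, fun r hr => returns_of_assignment hinj (fun x => ?_) hadm hr⟩
  exact ⟨y x, rfl, g x, by cases R <;> simp [EdgeRule.Allows], hy x⟩

theorem IsOptimal.returns (hO : IsOptimal I O) (hγ : (γ : EReal) ≤ opt I)
    {r : Option (Finset (Fin n))} (hr : FairPlusFlow I γ .atLeast (counts I O) r) :
    ∃ S, r = some S ∧ Feasible I S ∧ Apart I (d2 m γ) S := by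
  obtain ⟨Z, hZ, hr⟩ := hr
  obtain ⟨g, y, hsub, hy, hinj⟩ := hZ.exists_move (hO.apart hγ)
  rw [counts_eq_colourCount] at hr
  refine returns_of_assignment hinj (fun x => ?_)
    (admissible_colourCount hO.1 fun _ => subset_rfl) hr
  exact ⟨y x, rfl, g x, hsub x, hy x⟩

/-- `T` consists of selected points, at most one of every component. -/
structure IsTransversal (I : Instance m n) (γ : ℝ) (Z : Colour m → Finset (Fin n))
    (T : Finset (Fin n)) : Prop where
  selected : ∀ x ∈ T, ∃ L, x ∈ Z L
  eq_of_reachable : ∀ (x y : Selected Z), x.1 ∈ T → y.1 ∈ T →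
    (closeGraph I γ Z).Reachable x y → x = y

theorem IsSelection.exists_transversal (hZ : IsSelection I γ Z) (hγ : (γ : EReal) ≤ opt I) :
    ∃ T, IsTransversal I γ Z T ∧ Feasible I T := by
  obtain ⟨O, hO⟩ := exists_isOptimal I
  obtain ⟨g, y, hsub, hy, hinj⟩ := hZ.exists_move (hO.apart hγ)
  refine ⟨Finset.univ.image fun x => (y x).1, ⟨?_, ?_⟩, fun i => ?_⟩
  · intro x hx
    obtain ⟨u, -, rfl⟩ := Finset.mem_image.1 hx
    exact (y u).2
  · intro a b ha hb hab
    obtain ⟨u, -, hu⟩ := Finset.mem_image.1 ha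
    obtain ⟨v, -, hv⟩ := Finset.mem_image.1 hb
    obtain rfl : y u = a := Subtype.ext hu
    obtain rfl : y v = b := Subtype.ext hv
    rw [hinj (SimpleGraph.ConnectedComponent.eq.2 hab)]
  · refine (hO.1 i).trans ((card_inter_class_le hsub i).trans ?_)
    refine Finset.card_le_card_of_injOn (fun x => (y x).1) ?_ fun x _ x' _ h => hinj ?_
    · intro x hx
      rw [Finset.mem_coe, Finset.mem_inter, ← mem_colourOf, hZ.colourOf_eq (hy x)]
      exact ⟨Finset.mem_image_of_mem _ (Finset.mem_univ _), (Finset.mem_filter.1 hx).2⟩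
    · exact congrArg _ (Subtype.ext h)

theorem IsTransversal.exists_fairPlusFlow (hZ : IsSelection I γ Z) (hT : IsTransversal I γ Z T)
    (hfeas : Feasible I T) (R : EdgeRule) :
    ∃ c, Admissible I c ∧ FairPlusFlow I γ R c (some T) := by
  choose L hL using hT.selected
  let y : Coloured I T → Selected Z := fun x => ⟨x.1, L x.1 x.2.1, hL x.1 x.2.1⟩
  have hcol : ∀ x (hx : x ∈ T), colourOf I x = (L x hx).1 := fun x hx => hZ.colourOf_eq (hL x hx)
  have hinj : Function.Injective fun x => (closeGraph I γ Z).connectedComponentMk (y x) :=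
    fun a b hab => Subtype.ext <| congrArg (fun z : Selected Z => z.1) <|
      hT.eq_of_reachable (y a) (y b) a.2.1 b.2.1 (SimpleGraph.ConnectedComponent.eq.1 hab)
  have himage : (Finset.univ.image fun x => (y x).1) = T := by
    ext x
    rw [Finset.mem_image]
    exact ⟨fun ⟨u, _, hu⟩ => hu ▸ u.2.1,
      fun hx => ⟨⟨x, hx, hcol x hx ▸ (L x hx).2⟩, Finset.mem_univ _, rfl⟩⟩
  have hout := outcome_image (g := fun x => L x.1 x.2.1) hZ hinj (fun x => hL x.1 x.2.1) R
  rw [himage] at hout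
  exact ⟨_, admissible_colourCount hfeas fun x => (hcol x.1 x.2.1).subset, Z, hZ, hout⟩

end

/-! ### Programs with bounded loops -/

section
variable (s : Memory) {a b : ℕ} (i : ℕ)

@[simp]
theorem Memory.setNat_nat_self (a v : ℕ) :
    (s.setNat a i v).nat a = Function.update (s.nat a) i v := by
  simp [Memory.setNat]

@[simp]
theorem Memory.setNat_nat_of_ne (v : ℕ) (h : b ≠ a) : (s.setNat a i v).nat b = s.nat b := by
  simp [Memory.setNat, h]

@[simp]
theorem Memory.setNat_real (v : ℕ) : (s.setNat a i v).real = s.real := rfl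

@[simp]
theorem Memory.setReal_nat (v : ℝ) : (s.setReal a i v).nat = s.nat := rfl

@[simp]
theorem Memory.setReal_real_self (a : ℕ) (v : ℝ) :
    (s.setReal a i v).real a = Function.update (s.real a) i v := by
  simp [Memory.setReal]

@[simp]
theorem Memory.setReal_real_of_ne (v : ℝ) (h : b ≠ a) :
    (s.setReal a i v).real b = s.real b := by
  simp [Memory.setReal, h]

end

/-- The array whose entry `0` is meant to contain `(n + 1) ^ m`. -/
abbrev powArray : ℕ := 1

/-- The bounds of loops: a constant, the number of points, or entry `0` of `powArray`. -/
inductive Bound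
  | lit (c : ℕ)
  | size
  | pow

/-- The expression that evaluates to a bound. -/
def Bound.exp : Bound → NatExp
  | .lit c => .lit c
  | .size => .size
  | .pow => .get powArray (.lit 0)

/-- The value of a bound as a polynomial in `n`. -/
noncomputable def Bound.poly (m : ℕ) : Bound → Polynomial ℕ
  | .lit c => Polynomial.C c
  | .size => Polynomial.X
  | .pow => (Polynomial.X + 1) ^ m

/-- Programs all of whose loops are bounded. The counter of `for_ a b p` is entry `0` of array
`a`. -/
inductive Code
  | skip
  | setNat (a : ℕ) (i e : NatExp)
  | setReal (a : ℕ) (i : NatExp) (e : RealExp)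
  | seq (p q : Code)
  | ite (t : Test) (p q : Code)
  | for_ (a : ℕ) (b : Bound) (p : Code)

local notation:60 p:61 ";;" q:60 => Code.seq p q

namespace Code

/-- The machine program of a `while`-loop that runs a counter up to a bound. -/
def compileLoop (a : ℕ) (b : Bound) (p : Program) : Program :=
  .loop (.not (.natLe b.exp (.get a (.lit 0))))
    (.seq p (.setNat a (.lit 0) (.add (.get a (.lit 0)) (.lit 1))))

/-- Translation to the machine language. -/
def compile : Code → Program
  | skip => .skip
  | setNat a i e => .setNat a i e
  | setReal a i e => .setReal a i e
  | seq p q => .seq p.compile q.compile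
  | ite t p q => .ite t p.compile q.compile
  | for_ a b p => .seq (.setNat a (.lit 0) (.lit 0)) (compileLoop a b p.compile)

/-- May the program assign to the natural array `a`? The answer is a Boolean, so that concrete
instances hold by evaluation. -/
def writes (a : ℕ) : Code → Bool
  | skip => false
  | setNat b _ _ => a == b
  | setReal _ _ _ => false
  | seq p q => p.writes a || q.writes a
  | ite _ p q => p.writes a || q.writes a
  | for_ b _ p => a == b || p.writes a

/-- May the program assign to the real array `a`? -/
def writesReal (a : ℕ) : Code → Bool
  | skip => false
  | setNat _ _ _ => false
  | setReal b _ _ => a == b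
  | seq p q => p.writesReal a || q.writesReal a
  | ite _ p q => p.writesReal a || q.writesReal a
  | for_ _ _ p => p.writesReal a

/-- No loop assigns to its own counter in its body. -/
def countersSafe : Code → Bool
  | skip => true
  | setNat _ _ _ => true
  | setReal _ _ _ => true
  | seq p q => p.countersSafe && q.countersSafe
  | ite _ p q => p.countersSafe && q.countersSafe
  | for_ a _ p => !p.writes a && p.countersSafe

open Polynomial in
/-- A bound on the running time if entry `0` of `powArray` is at most `(n + 1) ^ m`. -/
noncomputable def timeBound (m : ℕ) : Code → Polynomial ℕ
  | skip => 1
  | setNat _ i e => C (i.cost + e.cost + 1)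
  | setReal _ i e => C (i.cost + e.cost + 1)
  | seq p q => p.timeBound m + q.timeBound m
  | ite t p q => C t.cost + (p.timeBound m + q.timeBound m)
  | for_ _ b p => C 9 + b.poly m * (p.timeBound m + C 12)

end Code

section
variable {m n : ℕ} (I : Instance m n)

/-- The memory after `k` rounds of a loop with body `F` and counter `a`. -/
def loopState (F : Memory → Memory) (a : ℕ) (s : Memory) : ℕ → Memory
  | 0 => s.setNat a 0 0
  | k + 1 => (F (loopState F a s k)).setNat a 0 (k + 1)

open Classical in
/-- The effect of a program on the memory. -/
noncomputable def Code.run : Code → Memory → Memory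
  | .skip, s => s
  | .setNat a i e, s => s.setNat a (i.eval I s) (e.eval I s)
  | .setReal a i e, s => s.setReal a (i.eval I s) (e.eval I s)
  | .seq p q, s => q.run (p.run s)
  | .ite t p q, s => if t.Holds I s then p.run s else q.run s
  | .for_ a b p, s => loopState p.run a s (b.exp.eval I s)

/-- The memories `s` and `s'` agree on the arrays to which `p` does not assign. -/
structure Frame (p : Code) (s s' : Memory) : Prop where
  nat : ∀ a, p.writes a = false → s'.nat a = s.nat a
  real : ∀ a, p.writesReal a = false → s'.real a = s.real a

variable {I}

theorem Frame.refl (p : Code) (s : Memory) : Frame p s s := ⟨fun _ _ => rfl, fun _ _ => rfl⟩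

theorem Frame.trans {p : Code} {s s' s'' : Memory} (h : Frame p s s') (h' : Frame p s' s'') :
    Frame p s s'' :=
  ⟨fun a ha => (h'.nat a ha).trans (h.nat a ha), fun a ha => (h'.real a ha).trans (h.real a ha)⟩

theorem Frame.mono {p q : Code} {s s' : Memory} (h : Frame p s s')
    (hnat : ∀ a, q.writes a = false → p.writes a = false)
    (hreal : ∀ a, q.writesReal a = false → p.writesReal a = false) : Frame q s s' :=
  ⟨fun a ha => h.nat a (hnat a ha), fun a ha => h.real a (hreal a ha)⟩

theorem Frame.setNat {a i v : ℕ} {p : Code} (s : Memory) (h : p.writes a = true) :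
    Frame p s (s.setNat a i v) where
  nat c hc := Memory.setNat_nat_of_ne _ _ _ fun hca => by simp [← hca, hc] at h
  real _ _ := rfl

theorem frame_loopState {a : ℕ} {b : Bound} {p : Code} {F : Memory → Memory}
    (hF : ∀ s, Frame p s (F s)) (s : Memory) (k : ℕ) :
    Frame (.for_ a b p) s (loopState F a s k) := by
  have hcounter : (Code.for_ a b p).writes a = true := by simp [Code.writes]
  induction k with
  | zero => exact .setNat s hcounter
  | succ k ih =>
    refine ih.trans (.trans ((hF _).mono (fun c hc => ?_) fun c hc => hc) (.setNat _ hcounter))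
    simp only [Code.writes, Bool.or_eq_false_iff] at hc
    exact hc.2

theorem Code.frame (p : Code) (s : Memory) : Frame p s (p.run I s) := by
  induction p generalizing s with
  | skip => exact .refl _ _
  | setNat a i e => exact .setNat s (by simp [Code.writes])
  | setReal a i e =>
    exact ⟨fun _ _ => rfl, fun c hc => Memory.setReal_real_of_ne _ _ _
      (by simpa [Code.writesReal] using hc)⟩
  | seq p q ihp ihq =>
    exact .trans ((ihp s).mono (by simp +contextual [Code.writes])
      (by simp +contextual [Code.writesReal]))
      ((ihq _).mono (by simp +contextual [Code.writes]) (by simp +contextual [Code.writesReal]))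
  | ite t p q ihp ihq =>
    rw [Code.run]
    split_ifs
    · exact (ihp s).mono (by simp +contextual [Code.writes])
        (by simp +contextual [Code.writesReal])
    · exact (ihq s).mono (by simp +contextual [Code.writes])
        (by simp +contextual [Code.writesReal])
  | for_ a b p ih => exact frame_loopState ih s _

theorem Bound.eval_exp_congr (b : Bound) {s s' : Memory}
    (h : s.nat powArray 0 = s'.nat powArray 0) : b.exp.eval I s = b.exp.eval I s' := by
  cases b <;> simp [Bound.exp, NatExp.eval, h]

theorem Bound.eval_exp_le (b : Bound) {s : Memory} (hs : s.nat powArray 0 ≤ (n + 1) ^ m) :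
    b.exp.eval I s ≤ (b.poly m).eval n := by
  cases b <;> simp [Bound.exp, Bound.poly, NatExp.eval, hs]

theorem loopState_counter (F : Memory → Memory) (a : ℕ) (s : Memory) (k : ℕ) :
    (loopState F a s k).nat a 0 = k := by
  cases k <;> simp [loopState]

/-- Every round costs at most `12` steps in addition to the body of the loop, and the last
evaluation of the condition at most `6`. -/
theorem exists_exec_compileLoop {a N T : ℕ} {b : Bound} {p : Code} {s : Memory}
    (ha : p.writes a = false)
    (hN : ∀ k, b.exp.eval I (loopState (p.run I) a s k) = N)
    (hT : ∀ k, ∃ t ≤ T, Exec I p.compile (loopState (p.run I) a s k) t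
      (p.run I (loopState (p.run I) a s k))) {i : ℕ} (hi : i ≤ N) :
    ∃ t ≤ 6 + (N - i) * (T + 12), Exec I (Code.compileLoop a b p.compile)
      (loopState (p.run I) a s i) t (loopState (p.run I) a s N) := by
  have hcost : b.exp.cost ≤ 2 := by cases b <;> simp [Bound.exp, NatExp.cost]
  induction hi using Nat.decreasingInduction with
  | self =>
    refine ⟨_, ?_, Exec.loop_stop ?_⟩
    · simp only [Test.cost, NatExp.cost]
      lia
    · simp [Test.Holds, hN, NatExp.eval, loopState_counter]
  | of_succ i hi ih =>
    obtain ⟨t₁, ht₁, hbody⟩ := hT i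
    obtain ⟨t₂, ht₂, hrest⟩ := ih
    have hincr := Exec.setNat (I := I) (p.run I (loopState (p.run I) a s i)) a (.lit 0)
      (.add (.get a (.lit 0)) (.lit 1))
    simp only [NatExp.eval, (p.frame _).nat a ha, loopState_counter] at hincr
    refine ⟨_, ?_, Exec.loop_step ?_ (Exec.seq hbody hincr) hrest⟩
    · obtain ⟨k, rfl⟩ := Nat.exists_eq_add_of_lt hi
      simp only [Test.cost, NatExp.cost, show i + k + 1 - i = k + 1 by lia,
        show i + k + 1 - (i + 1) = k by lia] at ht₂ ⊢
      rw [add_one_mul]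
      lia
    · simpa [Test.Holds, hN, NatExp.eval, loopState_counter] using hi

theorem Code.exists_exec {p : Code} (hp : p.countersSafe = true)
    (hpow : p.writes powArray = false) {s : Memory} (hs : s.nat powArray 0 ≤ (n + 1) ^ m) :
    ∃ t ≤ (p.timeBound m).eval n, Exec I p.compile s t (p.run I s) := by
  induction p generalizing s with
  | skip => exact ⟨1, by simp [Code.timeBound], Exec.skip s⟩
  | setNat a i e => exact ⟨_, by simp [Code.timeBound], Exec.setNat s a i e⟩
  | setReal a i e => exact ⟨_, by simp [Code.timeBound], Exec.setReal s a i e⟩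
  | seq p q ihp ihq =>
    simp only [Code.writes, Bool.or_eq_false_iff] at hpow
    simp only [Code.countersSafe, Bool.and_eq_true] at hp
    obtain ⟨t, ht, h⟩ := ihp hp.1 hpow.1 hs
    obtain ⟨t', ht', h'⟩ := ihq hp.2 hpow.2 (s := p.run I s)
      (by rwa [(p.frame s).nat _ hpow.1])
    exact ⟨t + t', by simpa [Code.timeBound] using add_le_add ht ht', Exec.seq h h'⟩
  | ite b p q ihp ihq =>
    simp only [Code.writes, Bool.or_eq_false_iff] at hpow
    simp only [Code.countersSafe, Bool.and_eq_true] at hp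
    simp only [Code.timeBound, Polynomial.eval_add, Polynomial.eval_C, Code.run]
    split_ifs with hb
    · obtain ⟨t, ht, h⟩ := ihp hp.1 hpow.1 hs
      exact ⟨b.cost + t, by lia, Exec.ite_true hb h⟩
    · obtain ⟨t, ht, h⟩ := ihq hp.2 hpow.2 hs
      exact ⟨b.cost + t, by lia, Exec.ite_false hb h⟩
  | for_ a b p ih =>
    have hframe := fun k => (frame_loopState (a := a) (b := b) (fun s => p.frame (I := I) s) s k)
    have hpow' : ∀ k, (loopState (p.run I) a s k).nat powArray = s.nat powArray := fun k =>
      (hframe k).nat _ hpow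
    simp only [Code.writes, Bool.or_eq_false_iff] at hpow
    simp only [Code.countersSafe, Bool.and_eq_true, Bool.not_eq_true'] at hp
    obtain ⟨t, ht, hloop⟩ := exists_exec_compileLoop hp.1
      (fun k => b.eval_exp_congr (congrFun (hpow' k) 0))
      (fun k => ih hp.2 hpow.2 (by rwa [hpow' k])) (Nat.zero_le (b.exp.eval I s))
    refine ⟨3 + t, ?_, Exec.seq (Exec.setNat s a (.lit 0) (.lit 0)) hloop⟩
    have hN := Nat.mul_le_mul_right ((p.timeBound m).eval n + 12) (b.eval_exp_le (I := I) hs)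
    simp only [Code.timeBound, Polynomial.eval_add, Polynomial.eval_mul, Polynomial.eval_C]
    lia

end

/-! ### Building blocks of programs -/

/-- The value in entry `0`; arrays of which only this entry is used serve as variables. -/
abbrev var (a : ℕ) : NatExp := .get a (.lit 0)

/-- `e 0 + ⋯ + e (c - 1)` -/
def NatExp.sum (c : ℕ) (e : ℕ → NatExp) : NatExp :=
  c.rec (.lit 0) fun i f => .add f (e i)

/-- `c * e`, as a repeated sum -/
def RealExp.smul (c : ℕ) (e : RealExp) : RealExp :=
  c.rec (.lit 0) fun _ f => .add f e

namespace Test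

/-- `e ≠ 0` -/
def nonzero (e : NatExp) : Test := .natLe (.lit 1) e

/-- `e = 0` -/
def zero (e : NatExp) : Test := .natLe e (.lit 0)

/-- `e < f` -/
def realLt (e f : RealExp) : Test := .not (.realLe f e)

end Test

namespace Code

/-- Run `p` if all the tests succeed. -/
def guard (ts : List Test) (p : Code) : Code :=
  ts.foldr (fun t q => .ite t q .skip) p

/-- Run `p` for all pairs of points. -/
def forPairs (a b : ℕ) (p : Code) : Code :=
  .for_ a .size (.for_ b .size p)

end Code

section
variable {m n : ℕ} (I : Instance m n) (s : Memory)

@[simp]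
theorem NatExp.eval_lit (c : ℕ) : (NatExp.lit c).eval I s = c := by simp [NatExp.eval]

@[simp]
theorem NatExp.eval_get (a : ℕ) (e : NatExp) :
    (NatExp.get a e).eval I s = s.nat a (e.eval I s) := by
  simp [NatExp.eval]

@[simp]
theorem NatExp.eval_add (e f : NatExp) : (e.add f).eval I s = e.eval I s + f.eval I s := by
  simp [NatExp.eval]

@[simp]
theorem NatExp.eval_sub (e f : NatExp) : (e.sub f).eval I s = e.eval I s - f.eval I s := by
  simp [NatExp.eval]

@[simp]
theorem NatExp.eval_sum (c : ℕ) (e : ℕ → NatExp) :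
    (NatExp.sum c e).eval I s = ∑ i : Fin c, (e i).eval I s := by
  induction c with
  | zero => simp [NatExp.sum]
  | succ c ih => simpa [NatExp.sum, Fin.sum_univ_castSucc] using ih

theorem NatExp.eval_quota {e : NatExp} {i : Fin m} (h : e.eval I s = i) :
    (NatExp.quota e).eval I s = I.k i := by
  simp [NatExp.eval, h]

theorem NatExp.eval_member {e f : NatExp} {x : Fin n} {i : Fin m} (hx : e.eval I s = x)
    (hi : f.eval I s = i) : (NatExp.member e f).eval I s = if x ∈ I.U i then 1 else 0 := by
  simp [NatExp.eval, hx, hi]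

@[simp]
theorem RealExp.eval_lit (c : ℕ) : (RealExp.lit c).eval I s = c := by simp [RealExp.eval]

@[simp]
theorem RealExp.eval_get (a : ℕ) (e : NatExp) :
    (RealExp.get a e).eval I s = s.real a (e.eval I s) := by
  simp [RealExp.eval]

@[simp]
theorem RealExp.eval_add (e f : RealExp) : (e.add f).eval I s = e.eval I s + f.eval I s := by
  simp [RealExp.eval]

@[simp]
theorem RealExp.eval_smul (c : ℕ) (e : RealExp) : (e.smul c).eval I s = c * e.eval I s := by
  induction c with
  | zero => simp [RealExp.smul]
  | succ c ih => simpa [RealExp.smul, add_one_mul] using ih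

theorem RealExp.eval_dist {e f : NatExp} {x y : Fin n} (hx : e.eval I s = x)
    (hy : f.eval I s = y) : (RealExp.dist e f).eval I s = I.d x y := by
  simp [RealExp.eval, hx, hy]

@[simp]
theorem Test.holds_natLe (e f : NatExp) :
    (Test.natLe e f).Holds I s ↔ e.eval I s ≤ f.eval I s := Iff.rfl

@[simp]
theorem Test.holds_realLe (e f : RealExp) :
    (Test.realLe e f).Holds I s ↔ e.eval I s ≤ f.eval I s := Iff.rfl

@[simp]
theorem Test.holds_nonzero (e : NatExp) : (Test.nonzero e).Holds I s ↔ e.eval I s ≠ 0 := by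
  simp [Test.nonzero, Nat.one_le_iff_ne_zero]

@[simp]
theorem Test.holds_zero (e : NatExp) : (Test.zero e).Holds I s ↔ e.eval I s = 0 := by
  simp [Test.zero]

@[simp]
theorem Test.holds_realLt (e f : RealExp) :
    (Test.realLt e f).Holds I s ↔ e.eval I s < f.eval I s := not_le

theorem Code.run_seq (p q : Code) : (p ;; q).run I s = q.run I (p.run I s) := rfl

theorem Code.run_setNat (a : ℕ) (e f : NatExp) :
    (Code.setNat a e f).run I s = s.setNat a (e.eval I s) (f.eval I s) := rfl

theorem Code.run_setReal (a : ℕ) (e : NatExp) (f : RealExp) :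
    (Code.setReal a e f).run I s = s.setReal a (e.eval I s) (f.eval I s) := rfl

open Classical in
theorem Code.run_guard (ts : List Test) (p : Code) :
    (Code.guard ts p).run I s = if ∀ t ∈ ts, t.Holds I s then p.run I s else s := by
  induction ts with
  | nil => simp [Code.guard]
  | cons t ts ih =>
    change (if t.Holds I s then (Code.guard ts p).run I s else s) = _
    rw [ih]
    simp only [List.forall_mem_cons, ite_and]

end

/-! ### Rules for loops -/

section
variable {m n : ℕ} {I : Instance m n} {s : Memory} {a N : ℕ} {b : Bound} {p : Code}

/-- The invariant is about a part `π s` of the memory that does not depend on the counter. -/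
theorem Code.run_for_of_invariant {α : Type*} (π : Memory → α)
    (hπ : ∀ s v, π (s.setNat a 0 v) = π s) (hN : b.exp.eval I s = N)
    (Inv : ℕ → α → Prop) (zero : Inv 0 (π s))
    (step : ∀ (i : Fin N) (s' : Memory), Frame (.for_ a b p) s s' → s'.nat a 0 = i →
      Inv i (π s') → Inv (i + 1) (π (p.run I s'))) :
    Inv N (π ((Code.for_ a b p).run I s)) := by
  suffices ∀ k ≤ N, Inv k (π (loopState (p.run I) a s k)) by
    simpa [Code.run, hN] using this N le_rfl
  intro k hk
  induction k with
  | zero => simpa [loopState, hπ] using zero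
  | succ k ih =>
    simpa only [loopState, hπ] using step ⟨k, hk⟩ _ (frame_loopState (fun s => p.frame s) s k)
      (loopState_counter ..) (ih (Nat.le_of_succ_le hk))

theorem Code.run_forPairs_of_invariant {a b : ℕ} {α : Type*} (π : Memory → α)
    (ha : ∀ s v, π (s.setNat a 0 v) = π s) (hb : ∀ s v, π (s.setNat b 0 v) = π s)
    (hcounter : (Code.for_ b .size p).writes a = false)
    (Inv : Set (Fin n × Fin n) → α → Prop) (empty : Inv ∅ (π s))
    (step : ∀ (D : Set (Fin n × Fin n)) (x y : Fin n) (s' : Memory),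
      Frame (.forPairs a b p) s s' → s'.nat a 0 = x → s'.nat b 0 = y →
      Inv D (π s') → Inv (insert (x, y) D) (π (p.run I s'))) :
    Inv Set.univ (π ((Code.forPairs a b p).run I s)) := by
  suffices Inv {q | (q.1 : ℕ) < n} (π ((Code.forPairs a b p).run I s)) by simpa using this
  refine Code.run_for_of_invariant (I := I) (b := .size) (N := n) π ha rfl
    (fun k => Inv {q | q.1 < k}) (by simpa using empty) fun x s₁ hs₁ hx h₁ => ?_
  have hrow : Inv ({q | q.1 < x} ∪ {q | q.1 = x ∧ (q.2 : ℕ) < n})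
      (π ((Code.for_ b .size p).run I s₁)) := by
    refine Code.run_for_of_invariant (b := .size) (N := n) π hb rfl
      (fun k => Inv ({q | q.1 < x} ∪ {q | q.1 = x ∧ q.2 < k})) (by simpa using h₁)
      fun y s₂ hs₂ hy h₂ => ?_
    have hs₂x : s₂.nat a 0 = x := by rw [hs₂.nat a hcounter, hx]
    convert step _ x y s₂ (hs₁.trans (hs₂.mono ?_ fun _ h => h)) hs₂x hy h₂ using 1
    · ext ⟨u, v⟩
      simp only [Set.mem_union, Set.mem_ofPred_eq, Nat.lt_succ_iff_lt_or_eq, ← Fin.ext_iff,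
        Set.mem_insert_iff, Prod.mk.injEq]
      tauto
    · simp +contextual [Code.writes]
  convert hrow using 1
  ext ⟨u, v⟩
  simp [le_iff_lt_or_eq, Fin.ext_iff]

variable {k : ℕ}

theorem Code.run_for_nat_of_invariant (hk : k ≠ a) (hN : b.exp.eval I s = N)
    (Inv : ℕ → (ℕ → ℕ) → Prop) (zero : Inv 0 (s.nat k))
    (step : ∀ (i : Fin N) (s' : Memory), Frame (.for_ a b p) s s' → s'.nat a 0 = i →
      Inv i (s'.nat k) → Inv (i + 1) ((p.run I s').nat k)) :
    Inv N (((Code.for_ a b p).run I s).nat k) :=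
  Code.run_for_of_invariant (fun s => s.nat k) (fun s v => s.setNat_nat_of_ne 0 v hk) hN Inv zero
    step

theorem Code.run_for_pointwise (hk : k ≠ a) (hN : b.exp.eval I s = N)
    (g : Fin N → ℕ → ℕ)
    (hp : ∀ (i : Fin N) (s' : Memory), Frame (.for_ a b p) s s' → s'.nat a 0 = i →
      (p.run I s').nat k = Function.update (s'.nat k) i (g i (s'.nat k i)))
    (i : Fin N) : ((Code.for_ a b p).run I s).nat k i = g i (s.nat k i) := by
  have h := Code.run_for_nat_of_invariant hk hN
    (fun i f => ∀ j : Fin N, f j = if j.val < i then g j (s.nat k j) else s.nat k j) (by simp)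
    fun i s' hs' hi h j => by
      rw [hp i s' hs' hi, Function.update_apply, h, h]
      rcases eq_or_ne j i with rfl | hji
      · simp
      · simp only [Fin.val_inj, hji, if_false, lt_irrefl, Nat.lt_succ_iff, le_iff_lt_or_eq,
          or_false]
  simpa using h i

theorem Code.run_for_search (hk : k ≠ a) (hN : b.exp.eval I s = N)
    (Q : Fin N → Prop) (v : Fin N → ℕ)
    (hfound : ∀ (i : Fin N) (s' : Memory), Frame (.for_ a b p) s s' → s'.nat a 0 = i → Q i →
      (p.run I s').nat k 0 = v i)
    (hskip : ∀ (i : Fin N) (s' : Memory), Frame (.for_ a b p) s s' → s'.nat a 0 = i → ¬ Q i →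
      (p.run I s').nat k 0 = s'.nat k 0) :
    (∃ i, Q i ∧ ((Code.for_ a b p).run I s).nat k 0 = v i) ∨
      (∀ i, ¬ Q i) ∧ ((Code.for_ a b p).run I s).nat k 0 = s.nat k 0 := by
  have h := Code.run_for_nat_of_invariant hk hN
    (fun i f => (∃ j, Q j ∧ f 0 = v j) ∨ (∀ j : Fin N, j.val < i → ¬ Q j) ∧ f 0 = s.nat k 0)
    (by simp) fun i s' hs' hi h => by
      by_cases hQ : Q i
      · exact .inl ⟨i, hQ, hfound i s' hs' hi hQ⟩
      · rw [hskip i s' hs' hi hQ]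
        refine h.imp_right fun h => ⟨fun j hj => ?_, h.2⟩
        obtain hj | hj := Nat.lt_succ_iff_lt_or_eq.1 hj
        · exact h.1 j hj
        · rwa [Fin.ext hj]
  simpa using h

theorem sum_filter_val_lt_succ {α : Type*} [AddCommMonoid α] (g : Fin N → α) (i : Fin N) :
    ∑ j : Fin N with j.val < i.val + 1, g j = ∑ j : Fin N with j.val < i.val, g j + g i := by
  have h : ({j | j.val < i.val + 1} : Finset (Fin N)) =
      insert i ({j | j.val < i.val} : Finset (Fin N)) := by
    ext j
    simp [le_iff_eq_or_lt, Fin.ext_iff]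
  rw [h, Finset.sum_insert (by simp), add_comm]

theorem Code.run_for_sum (hk : k ≠ a) (hN : b.exp.eval I s = N)
    (g : Fin N → ℕ)
    (hp : ∀ (i : Fin N) (s' : Memory), Frame (.for_ a b p) s s' → s'.nat a 0 = i →
      (p.run I s').nat k 0 = s'.nat k 0 + g i) :
    ((Code.for_ a b p).run I s).nat k 0 = s.nat k 0 + ∑ i, g i := by
  have h := Code.run_for_nat_of_invariant hk hN
    (fun i f => f 0 = s.nat k 0 + ∑ j : Fin N with j.val < i, g j) (by simp) fun i s' hs' hi h => by
      rw [hp i s' hs' hi, h, sum_filter_val_lt_succ, add_assoc]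
  simpa using h

end

/-! ### Weights, powers and guesses -/

abbrev outputArray : ℕ := 0
abbrev powerVar : ℕ := 2
abbrev weightArray : ℕ := 3
abbrev twoPowArray : ℕ := 4
abbrev selArray : ℕ := 5
abbrev labelArray : ℕ := 6
abbrev tableArray : ℕ := 7
abbrev oldTableArray : ℕ := 8
abbrev foundVar : ℕ := 9
abbrev bestCodeVar : ℕ := 10
abbrev flagVar : ℕ := 11
abbrev restVar : ℕ := 12
abbrev countVar : ℕ := 13
abbrev sourceVar : ℕ := 14
abbrev targetVar : ℕ := 15
abbrev levelCounter : ℕ := 20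
abbrev xCounter : ℕ := 21
abbrev yCounter : ℕ := 22
abbrev uCounter : ℕ := 23
abbrev labelCounter : ℕ := 24
abbrev weightCounter : ℕ := 25
abbrev classCounter : ℕ := 26
abbrev gammaXCounter : ℕ := 27
abbrev gammaYCounter : ℕ := 28
abbrev gammaVar : ℕ := 0
abbrev bestVar : ℕ := 1

/-- The weights of the points of a set add up to the number whose digits in base `n + 1` are the
numbers of points in the classes. -/
def weight {m n : ℕ} (I : Instance m n) (x : Fin n) : ℕ :=
  ∑ i, if x ∈ I.U i then (n + 1) ^ (i : ℕ) else 0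

def addPowerCode : Code :=
  .for_ xCounter .size (
    .guard [.nonzero (.member (var xCounter) (var classCounter))] (
      .setNat weightArray (var xCounter) (.add (.get weightArray (var xCounter)) (var powerVar))))

def nextPowerCode : Code :=
  .setNat countVar (.lit 0) (.lit 0) ;;
  .for_ xCounter .size (.setNat countVar (.lit 0) (.add (var countVar) (var powerVar))) ;;
  .setNat powerVar (.lit 0) (.add (var powerVar) (var countVar))

def weightsCode (m : ℕ) : Code :=
  .setNat powerVar (.lit 0) (.lit 1) ;;
  .for_ classCounter (.lit m) (addPowerCode ;; nextPowerCode)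

def twoPowersCode : Code :=
  .setNat twoPowArray (.lit 0) (.lit 1) ;;
  .for_ xCounter .size (
    .setNat twoPowArray (.add (var xCounter) (.lit 1))
      (.add (.get twoPowArray (var xCounter)) (.get twoPowArray (var xCounter))))

/-- `3 M - 1` as a natural number -/
def denominator (m : ℕ) : ℕ := 3 * bigM m - 1

/-- Computes a guess that exceeds `(3 M - 1) d x y` for all points `x`, `y`. -/
def hugeCode (m : ℕ) : Code :=
  .setReal gammaVar (.lit 0) (.lit 1) ;;
  .forPairs xCounter yCounter (
    .setReal gammaVar (.lit 0) (.add (.get gammaVar (.lit 0))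
      (.smul (denominator m) (.dist (var xCounter) (var yCounter)))))

section
variable {m n : ℕ} {I : Instance m n} {s : Memory}

theorem cast_denominator (m : ℕ) : (denominator m : ℝ) = 3 * bigM m - 1 := by
  have := bigM_pos m
  rw [denominator, Nat.cast_sub (by lia)]
  simp

theorem run_addPowerCode {i : Fin m} (hi : s.nat classCounter 0 = i) (x : Fin n) :
    (addPowerCode.run I s).nat weightArray x =
      s.nat weightArray x + if x ∈ I.U i then s.nat powerVar 0 else 0 := by
  refine Code.run_for_pointwise (b := .size) (N := n) (by decide) rfl
    (fun x w => w + if x ∈ I.U i then s.nat powerVar 0 else 0) (fun x s' hs' hx => ?_) x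
  have hmem := NatExp.eval_member I s' (e := var xCounter) (f := var classCounter)
    (by simpa using hx) (by simpa [hs'.nat classCounter rfl] using hi)
  rw [Code.run_guard]
  by_cases hxi : x ∈ I.U i
  · simp [hmem, hxi, Code.run_setNat, hx, hs'.nat powerVar rfl]
  · simp [hmem, hxi]

theorem run_nextPowerCode :
    (nextPowerCode.run I s).nat powerVar 0 = s.nat powerVar 0 * (n + 1) := by
  have hcount := Code.run_for_sum (I := I) (s := s.setNat countVar 0 0) (a := xCounter)
    (b := .size) (N := n) (p := .setNat countVar (.lit 0) (.add (var countVar) (var powerVar)))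
    (k := countVar) (by decide) rfl (fun _ => s.nat powerVar 0)
    (fun x s' hs' _ => by simp [Code.run_setNat, hs'.nat powerVar rfl])
  simp only [nextPowerCode, Code.run_seq, Code.run_setNat, NatExp.eval_add, NatExp.eval_get,
    NatExp.eval_lit, Memory.setNat_nat_self, Function.update_self, hcount]
  rw [(Code.frame _ _).nat powerVar rfl]
  simp [mul_add_one, mul_comm n, add_comm]

theorem run_weightsCode (h : ∀ x : Fin n, s.nat weightArray x = 0) :
    ((weightsCode m).run I s).nat powerVar 0 = (n + 1) ^ m ∧
      ∀ x : Fin n, ((weightsCode m).run I s).nat weightArray x = weight I x := by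
  suffices ((weightsCode m).run I s).nat powerVar 0 = (n + 1) ^ m ∧
      ∀ x : Fin n, ((weightsCode m).run I s).nat weightArray x =
        ∑ i : Fin m with i.val < m, if x ∈ I.U i then (n + 1) ^ (i : ℕ) else 0 by
    simpa [weight] using this
  refine Code.run_for_of_invariant (b := .lit m) (N := m)
    (fun s => (s.nat powerVar 0, s.nat weightArray)) (fun _ _ => rfl) rfl
    (fun k q => q.1 = (n + 1) ^ k ∧ ∀ x : Fin n,
      q.2 x = ∑ i : Fin m with i.val < k, if x ∈ I.U i then (n + 1) ^ (i : ℕ) else 0)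
    (by simp [Code.run_setNat, h]) fun i s' _ hi ⟨hpower, hweight⟩ => ⟨?_, fun x => ?_⟩ <;>
    dsimp only at hpower hweight
  · simp only [Code.run_seq, run_nextPowerCode]
    rw [(Code.frame _ _).nat powerVar rfl, hpower, pow_succ]
  · simp only [Code.run_seq]
    rw [(Code.frame _ _).nat weightArray rfl, run_addPowerCode hi, hweight, hpower,
      sum_filter_val_lt_succ]

theorem run_twoPowersCode (x : ℕ) (hx : x ≤ n) :
    (twoPowersCode.run I s).nat twoPowArray x = 2 ^ x := by
  refine Code.run_for_nat_of_invariant (b := .size) (N := n) (k := twoPowArray) (by decide) rfl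
    (fun i f => ∀ j ≤ i, f j = 2 ^ j) (by simp [Code.run_setNat]) (fun i s' _ hi h j hj => ?_) x hx
  simp only [Code.run_setNat, NatExp.eval_add, NatExp.eval_get, NatExp.eval_lit, hi,
    Memory.setNat_nat_self, Function.update_apply]
  split_ifs with hji
  · rw [hji, h i le_rfl]
    lia
  · exact h j (by lia)

theorem run_hugeCode :
    0 < ((hugeCode m).run I s).real gammaVar 0 ∧
      ∀ x y, denominator m * I.d x y < ((hugeCode m).run I s).real gammaVar 0 := by
  have h := Code.run_forPairs_of_invariant (I := I) (s := s.setReal gammaVar 0 1)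
    (a := xCounter) (b := yCounter)
    (p := .setReal gammaVar (.lit 0) (.add (.get gammaVar (.lit 0))
      (.smul (denominator m) (.dist (var xCounter) (var yCounter)))))
    (fun s => s.real gammaVar 0) (fun _ _ => rfl) (fun _ _ => rfl) rfl
    (fun D γ => 0 < γ ∧ ∀ q ∈ D, denominator m * I.d q.1 q.2 < γ) (by simp)
    fun D x y s' _ hx hy ⟨hpos, h⟩ => by
      have hd : 0 ≤ denominator m * I.d x y := mul_nonneg (Nat.cast_nonneg _) (I.d_nonneg x y)
      simp only [Code.run_setReal, RealExp.eval_add, RealExp.eval_smul, RealExp.eval_get,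
        RealExp.eval_dist I s' (x := x) (y := y) (e := var xCounter) (f := var yCounter)
          (by simpa using hx) (by simpa using hy), NatExp.eval_lit, Memory.setReal_real_self,
        Function.update_self, Set.forall_mem_insert]
      exact ⟨by linarith [hpos], by linarith [hpos], fun q hq => by linarith [h q hq]⟩
  simpa [hugeCode, Code.run_seq, Code.run_setReal] using h

end

/-! ### The selection -/

/-- The points whose entries are not zero. -/
def supp (n : ℕ) (z : ℕ → ℕ) : Finset (Fin n) := Finset.univ.filter fun x => z x ≠ 0

def colourCardExp (m : ℕ) (x : NatExp) : NatExp := .sum m fun i => .member x (.lit i)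

/-- The number of classes that contain the first point but not the second. -/
def colourDiffExp (m : ℕ) (x y : NatExp) : NatExp :=
  .sum m fun i => .sub (.member x (.lit i)) (.member y (.lit i))

def blockingTests (m : ℕ) : List Test :=
  [.nonzero (.get selArray (var yCounter)),
    .zero (colourDiffExp m (var xCounter) (var yCounter)),
    .realLt (.smul (denominator m) (.dist (var xCounter) (var yCounter)))
      (.smul (bigM m) (.get gammaVar (.lit 0)))]

def findBlockingCode (m : ℕ) : Code :=
  .setNat flagVar (.lit 0) (.lit 0) ;;
  .for_ yCounter .size (.guard (blockingTests m) (.setNat flagVar (.lit 0) (.lit 1)))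

def selectPointCode (m : ℕ) : Code :=
  findBlockingCode m ;;
  .guard [.zero (var flagVar)] (.setNat selArray (var xCounter) (.lit 1))

def selectLevelCode (m : ℕ) : Code :=
  .for_ xCounter .size (
    .guard [.natLe (.add (colourCardExp m (var xCounter)) (var levelCounter)) (.lit m),
      .natLe (.lit m) (.add (colourCardExp m (var xCounter)) (var levelCounter))]
      (selectPointCode m))

def selectCode (m : ℕ) : Code :=
  .for_ xCounter .size (.setNat selArray (var xCounter) (.lit 0)) ;;
  .for_ levelCounter (.lit m) (selectLevelCode m)

/-- The points that have been treated when the point `k` of round `l` is considered; this round is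
about the points in `m - l` classes. -/
def treated {m n : ℕ} (I : Instance m n) (l k : ℕ) : Finset (Fin n) :=
  Finset.univ.filter fun y =>
    m < (colourOf I y).card + l ∨ (colourOf I y).card + l = m ∧ y.val < k

section
variable {m n : ℕ} {I : Instance m n} {s : Memory}

theorem mem_supp {z : ℕ → ℕ} {x : Fin n} : x ∈ supp n z ↔ z x ≠ 0 := by
  simp [supp]

theorem supp_update {z : ℕ → ℕ} {x : Fin n} :
    supp n (Function.update z x 1) = insert x (supp n z) := by
  ext y
  by_cases h : y = x
  · simp [mem_supp, h]
  · simp [mem_supp, h, Fin.val_inj]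

theorem eval_colourCardExp {e : NatExp} {x : Fin n} (hx : e.eval I s = x) :
    (colourCardExp m e).eval I s = (colourOf I x).card := by
  simp only [colourCardExp, NatExp.eval_sum,
    NatExp.eval_member I s hx (NatExp.eval_lit I s _), colourOf, Finset.card_filter]

theorem eval_colourDiffExp_eq_zero {e f : NatExp} {x y : Fin n} (hx : e.eval I s = x)
    (hy : f.eval I s = y) :
    (colourDiffExp m e f).eval I s = 0 ↔ colourOf I x ⊆ colourOf I y := by
  simp only [colourDiffExp, NatExp.eval_sum, NatExp.eval_sub,
    NatExp.eval_member I s hx (NatExp.eval_lit I s _),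
    NatExp.eval_member I s hy (NatExp.eval_lit I s _), Finset.sum_eq_zero_iff,
    Finset.subset_iff, mem_colourOf, Finset.mem_univ, true_imp_iff]
  refine forall_congr' fun i => ?_
  by_cases hxi : x ∈ I.U i <;> by_cases hyi : y ∈ I.U i <;> simp [hxi, hyi]

theorem denominator_mul_lt_iff {γ r : ℝ} :
    denominator m * r < bigM m * γ ↔ r < d1 m γ := by
  rw [d1, lt_div_iff₀ (denominator_pos m), cast_denominator, mul_comm]

theorem forall_mem_blockingTests {x y : Fin n} (hx : s.nat xCounter 0 = x)
    (hy : s.nat yCounter 0 = y) :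
    (∀ t ∈ blockingTests m, t.Holds I s) ↔ y ∈ supp n (s.nat selArray) ∧
      colourOf I x ⊆ colourOf I y ∧ I.d x y < d1 m (s.real gammaVar 0) := by
  have hxe : (var xCounter).eval I s = x := by simpa using hx
  have hye : (var yCounter).eval I s = y := by simpa using hy
  simp [blockingTests, eval_colourDiffExp_eq_zero hxe hye, RealExp.eval_dist I s hxe hye, hy,
    denominator_mul_lt_iff, mem_supp]

theorem run_findBlockingCode {x : Fin n} (hx : s.nat xCounter 0 = x) :
    ((findBlockingCode m).run I s).nat flagVar 0 = 0 ↔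
      ¬ Blocked I (d1 m (s.real gammaVar 0)) (supp n (s.nat selArray)) x := by
  set Blocks : Fin n → Prop := fun y => y ∈ supp n (s.nat selArray) ∧
    colourOf I x ⊆ colourOf I y ∧ I.d x y < d1 m (s.real gammaVar 0) with hBlocks
  have hsearch : (∃ y, Blocks y ∧ ((findBlockingCode m).run I s).nat flagVar 0 = 1) ∨
      (∀ y, ¬ Blocks y) ∧ ((findBlockingCode m).run I s).nat flagVar 0 = 0 := by
    refine Code.run_for_search (b := .size) (N := n) (k := flagVar)
      (s := s.setNat flagVar 0 0) (by decide) rfl Blocks (fun _ => 1)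
      (fun y s' hs' hy hyBlocks => ?_) (fun y s' hs' hy hyBlocks => ?_)
    all_goals
      have htests := forall_mem_blockingTests (I := I)
        ((congrFun (hs'.nat xCounter rfl) 0).trans hx) hy
      rw [hs'.nat selArray rfl, hs'.real gammaVar rfl] at htests
    · rw [Code.run_guard, if_pos (htests.2 hyBlocks)]
      simp [Code.run_setNat]
    · rw [Code.run_guard, if_neg (mt htests.1 hyBlocks)]
  have hblocked : Blocked I (d1 m (s.real gammaVar 0)) (supp n (s.nat selArray)) x ↔
      ∃ y, Blocks y := by
    simp only [Blocked, hBlocks]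
  rw [hblocked, not_exists]
  rcases hsearch with ⟨y, hy, hflag⟩ | ⟨hnone, hflag⟩
  · simpa [hflag] using ⟨y, hy⟩
  · simpa [hflag] using hnone

theorem run_selectPointCode {D : Finset (Fin n)} {x : Fin n} (hx : s.nat xCounter 0 = x)
    (h : IsGreedy I (d1 m (s.real gammaVar 0)) D (supp n (s.nat selArray)))
    (hcard : ∀ y ∈ D, (colourOf I x).card ≤ (colourOf I y).card) :
    IsGreedy I (d1 m (s.real gammaVar 0)) (insert x D)
      (supp n (((selectPointCode m).run I s).nat selArray)) := by
  have hframe := Code.frame (I := I) (findBlockingCode m) s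
  rw [selectPointCode, Code.run_seq, Code.run_guard]
  by_cases hblocked : Blocked I (d1 m (s.real gammaVar 0)) (supp n (s.nat selArray)) x
  · have hflag := (run_findBlockingCode hx).not_left.2 hblocked
    simpa [hflag, hframe.nat selArray rfl] using h.insert_of_blocked hblocked
  · have hflag := (run_findBlockingCode hx).2 hblocked
    simpa [hflag, Code.run_setNat, hframe.nat selArray rfl, hframe.nat xCounter rfl, hx,
      supp_update] using h.insert_of_not_blocked hcard hblocked

theorem run_selectLevelCode {l : ℕ} (hl : s.nat levelCounter 0 = l)
    (h : IsGreedy I (d1 m (s.real gammaVar 0)) (treated I l 0) (supp n (s.nat selArray))) :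
    IsGreedy I (d1 m (s.real gammaVar 0)) (treated I l n)
      (supp n (((selectLevelCode m).run I s).nat selArray)) := by
  refine Code.run_for_nat_of_invariant (b := .size) (N := n) (by decide) rfl
    (fun k z => IsGreedy I (d1 m (s.real gammaVar 0)) (treated I l k) (supp n z)) h
    fun x s' hs' hx h => ?_
  have hcard : (colourCardExp m (var xCounter)).eval I s' = (colourOf I x).card :=
    eval_colourCardExp (by simpa using hx)
  simp only [Code.run_guard, List.forall_mem_cons, List.not_mem_nil, false_imp_iff, implies_true,
    and_true, Test.holds_natLe, NatExp.eval_add, hcard, NatExp.eval_get, NatExp.eval_lit,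
    hs'.nat levelCounter rfl, hl, ← le_antisymm_iff]
  split_ifs with hlevel
  · have htreated : treated I l (x + 1) = insert x (treated I l x) := by
      ext y
      simp only [treated, Finset.mem_filter_univ, Finset.mem_insert, Fin.ext_iff]
      grind
    rw [← hs'.real gammaVar rfl] at h ⊢
    rw [htreated]
    refine run_selectPointCode hx h fun y hy => ?_
    simp only [treated, Finset.mem_filter_univ] at hy
    lia
  · have htreated : treated I l (x + 1) = treated I l x := by
      ext y
      simp only [treated, Finset.mem_filter_univ]
      grind
    rwa [htreated]

theorem run_selectCode :
    IsGreedy I (d1 m (s.real gammaVar 0)) {x | (colourOf I x).Nonempty}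
      (supp n (((selectCode m).run I s).nat selArray)) := by
  have htreated : treated I m 0 = ({x | (colourOf I x).Nonempty} : Finset (Fin n)) := by
    ext x
    simp [treated, Finset.card_pos]
  have hcleared (x : Fin n) :
      ((Code.for_ xCounter .size (.setNat selArray (var xCounter) (.lit 0))).run I s).nat
        selArray x = 0 :=
    Code.run_for_pointwise (b := .size) (N := n) (by decide) rfl (fun _ _ => 0)
      (fun x s' _ hx => by simp [Code.run_setNat, hx]) x
  rw [← htreated, selectCode, Code.run_seq]
  refine Code.run_for_nat_of_invariant (b := .lit m) (N := m) (by decide) rfl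
    (fun l z => IsGreedy I (d1 m (s.real gammaVar 0)) (treated I l 0) (supp n z)) ?_
    fun l s' hs' hl h => ?_
  · have huntreated : treated I 0 0 = ∅ := by
      ext x
      simpa [treated] using Finset.card_le_univ (colourOf I x)
    have hempty : supp n (((Code.for_ xCounter .size
        (.setNat selArray (var xCounter) (.lit 0))).run I s).nat selArray) = ∅ := by
      ext x
      simp [mem_supp, hcleared]
    rw [huntreated, hempty]
    exact IsGreedy.empty
  · have hround : treated I (l + 1) 0 = treated I l n := by
      ext x
      simp only [treated, Finset.mem_filter_univ, x.isLt]
      lia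
    have hγ : s'.real gammaVar 0 = s.real gammaVar 0 := by
      rw [hs'.real gammaVar rfl, (Code.frame _ _).real gammaVar rfl]
    rw [hround, ← hγ]
    exact run_selectLevelCode hl (hγ ▸ h)

end

/-! ### The components -/

/-- Give all points with label `sourceVar` the label `targetVar`. -/
def relabelCode : Code :=
  .for_ uCounter .size (
    .guard [.natLe (.get labelArray (var uCounter)) (var sourceVar),
      .natLe (var sourceVar) (.get labelArray (var uCounter))]
      (.setNat labelArray (var uCounter) (var targetVar)))

def mergeCode : Code :=
  .setNat sourceVar (.lit 0) (.get labelArray (var xCounter)) ;;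
  .setNat targetVar (.lit 0) (.get labelArray (var yCounter)) ;;
  relabelCode

def closeTests (m : ℕ) : List Test :=
  [.nonzero (.get selArray (var xCounter)),
    .nonzero (.get selArray (var yCounter)),
    .realLt (.smul (denominator m) (.dist (var xCounter) (var yCounter))) (.get gammaVar (.lit 0))]

def componentsCode (m : ℕ) : Code :=
  .for_ xCounter .size (.setNat labelArray (var xCounter) (var xCounter)) ;;
  .forPairs xCounter yCounter (.guard (closeTests m) mergeCode)

/-- `lab` labels the points by the classes of the equivalence relation that `r` generates. -/
structure IsLabelling {n : ℕ} (r : Fin n → Fin n → Prop) (lab : ℕ → ℕ) : Prop where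
  lt : ∀ u : Fin n, lab u < n
  eq_iff : ∀ u v : Fin n, lab u = lab v ↔ Relation.EqvGen r u v

section
variable {n : ℕ} {r : Fin n → Fin n → Prop} {lab lab' : ℕ → ℕ}

theorem IsLabelling.of_forall_eq_self (h : ∀ u : Fin n, lab u = u) :
    IsLabelling (fun _ _ : Fin n => False) lab where
  lt u := by simp [h]
  eq_iff u v := by
    rw [h, h, Fin.val_inj]
    constructor
    · rintro rfl
      exact .refl u
    · exact fun huv => eq_equivalence.eqvGen_iff.1 (huv.mono fun _ _ => False.elim)

theorem IsLabelling.insert (h : IsLabelling r lab) (x y : Fin n)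
    (h' : ∀ u : Fin n, lab' u = if lab u = lab x then lab y else lab u) :
    IsLabelling (fun u v => r u v ∨ u = x ∧ v = y) lab' where
  lt u := by
    rw [h']
    split_ifs
    exacts [h.lt y, h.lt u]
  eq_iff u v := by
    have hgen {u v : Fin n} (huv : lab u = lab v) :
        Relation.EqvGen (fun u v => r u v ∨ u = x ∧ v = y) u v :=
      ((h.eq_iff u v).1 huv).mono fun _ _ => .inl
    have hxy : Relation.EqvGen (fun u v => r u v ∨ u = x ∧ v = y) x y := .rel _ _ (.inr ⟨rfl, rfl⟩)
    constructor
    · intro huv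
      rw [h', h'] at huv
      split_ifs at huv with hu hv hv
      · exact hgen (hu.trans hv.symm)
      · exact ((hgen hu).trans _ _ _ hxy).trans _ _ _ (hgen huv)
      · exact (hgen huv).trans _ _ _ ((hxy.symm _ _).trans _ _ _ (hgen hv.symm))
      · exact hgen huv
    · have hker : Equivalence fun u v : Fin n => lab' u = lab' v :=
        ⟨fun _ => rfl, Eq.symm, Eq.trans⟩
      refine fun huv => hker.eqvGen_iff.1 (huv.mono ?_)
      rintro u v (huv | ⟨rfl, rfl⟩)
      · rw [h', h', (h.eq_iff u v).2 (.rel _ _ huv)]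
      · rw [h', h', if_pos rfl, ite_self]

end

section
variable {m n : ℕ} {I : Instance m n} {γ : ℝ} {A : Finset (Fin n)} {s : Memory}

/-- `u` and `v` are points of `A` that are less than `d2` apart; for a selection `A`, these are the
edges of the graph `G_Z` and the loops. -/
def IsClose (I : Instance m n) (γ : ℝ) (A : Finset (Fin n)) (u v : Fin n) : Prop :=
  u ∈ A ∧ v ∈ A ∧ I.d u v < d2 m γ

theorem reachable_iff_eqvGen (hA : ∀ x ∈ A, (colourOf I x).Nonempty)
    (x y : Selected (colourClasses I A)) :
    (closeGraph I γ (colourClasses I A)).Reachable x y ↔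
      Relation.EqvGen (IsClose I γ A) x.1 y.1 := by
  have hmem (x : Fin n) : (∃ L, x ∈ colourClasses I A L) ↔ x ∈ A :=
    ⟨fun ⟨_, hx⟩ => (mem_colourClasses.1 hx).1,
      fun hx => ⟨⟨_, hA x hx⟩, mem_colourClasses.2 ⟨hx, rfl⟩⟩⟩
  constructor
  · rintro ⟨p⟩
    induction p with
    | nil => exact .refl _
    | @cons u v _ huv _ ih =>
      exact .trans _ _ _ (.rel _ _ ⟨(hmem u).1 u.2, (hmem v).1 v.2, huv.2⟩) ih
  · intro hxy
    have hequiv : Equivalence fun u v : Fin n => u = v ∨ ∃ hu hv,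
        (closeGraph I γ (colourClasses I A)).Reachable ⟨u, hu⟩ ⟨v, hv⟩ := by
      refine ⟨fun _ => .inl rfl, ?_, ?_⟩
      · rintro u v (rfl | ⟨hu, hv, huv⟩)
        exacts [.inl rfl, .inr ⟨hv, hu, huv.symm⟩]
      · rintro u v w (rfl | ⟨hu, hv, huv⟩) (rfl | ⟨hv', hw, hvw⟩)
        exacts [.inl rfl, .inr ⟨hv', hw, hvw⟩, .inr ⟨hu, hv, huv⟩, .inr ⟨hu, hw, huv.trans hvw⟩]
    obtain h | ⟨_, _, h⟩ := hequiv.eqvGen_iff.1 (hxy.mono fun u v ⟨hu, hv, huv⟩ =>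
      or_iff_not_imp_left.2 fun hne => ⟨(hmem u).2 hu, (hmem v).2 hv,
        SimpleGraph.Adj.reachable ⟨fun h => hne (congrArg Subtype.val h), huv⟩⟩)
    · rw [Subtype.ext h]
    · exact h

theorem isTransversal_iff {T : Finset (Fin n)} {lab : ℕ → ℕ}
    (hA : ∀ x ∈ A, (colourOf I x).Nonempty) (hlab : IsLabelling (IsClose I γ A) lab) :
    IsTransversal I γ (colourClasses I A) T ↔ T ⊆ A ∧ Set.InjOn (fun x : Fin n => lab x) T := by
  have hmem (x : Fin n) (hx : x ∈ A) : ∃ L, x ∈ colourClasses I A L :=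
    ⟨⟨_, hA x hx⟩, mem_colourClasses.2 ⟨hx, rfl⟩⟩
  constructor
  · intro h
    have hTA : T ⊆ A := fun x hx => (mem_colourClasses.1 (h.selected x hx).choose_spec).1
    refine ⟨hTA, fun x hx y hy hxy => ?_⟩
    exact congrArg Subtype.val (h.eq_of_reachable ⟨x, hmem x (hTA hx)⟩ ⟨y, hmem y (hTA hy)⟩ hx hy
      ((reachable_iff_eqvGen hA _ _).2 ((hlab.eq_iff x y).1 hxy)))
  · rintro ⟨hTA, hinj⟩
    refine ⟨fun x hx => hmem x (hTA hx), fun x y hx hy hxy => Subtype.ext (hinj hx hy ?_)⟩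
    exact (hlab.eq_iff _ _).2 ((reachable_iff_eqvGen hA x y).1 hxy)

theorem denominator_mul_lt_iff_lt_d2 {r : ℝ} : denominator m * r < γ ↔ r < d2 m γ := by
  rw [d2, lt_div_iff₀ (denominator_pos m), cast_denominator, mul_comm]

theorem forall_mem_closeTests {x y : Fin n} (hx : s.nat xCounter 0 = x)
    (hy : s.nat yCounter 0 = y) :
    (∀ t ∈ closeTests m, t.Holds I s) ↔
      IsClose I (s.real gammaVar 0) (supp n (s.nat selArray)) x y := by
  have hxe : (var xCounter).eval I s = x := by simpa using hx
  have hye : (var yCounter).eval I s = y := by simpa using hy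
  simp [closeTests, IsClose, RealExp.eval_dist I s hxe hye, hx, hy, denominator_mul_lt_iff_lt_d2,
    mem_supp]

theorem run_relabelCode (u : Fin n) :
    (relabelCode.run I s).nat labelArray u =
      if s.nat labelArray u = s.nat sourceVar 0 then s.nat targetVar 0
      else s.nat labelArray u := by
  refine Code.run_for_pointwise (b := .size) (N := n) (by decide) rfl
    (fun _ l => if l = s.nat sourceVar 0 then s.nat targetVar 0 else l) (fun u s' hs' hu => ?_) u
  rw [Code.run_guard]
  simp only [List.forall_mem_cons, List.not_mem_nil, false_imp_iff, implies_true, and_true,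
    Test.holds_natLe, NatExp.eval_get, NatExp.eval_lit, hu, hs'.nat sourceVar rfl,
    ← le_antisymm_iff]
  split_ifs with h
  · simp [Code.run_setNat, hu, hs'.nat targetVar rfl]
  · simp

theorem run_mergeCode {x y : Fin n} (hx : s.nat xCounter 0 = x) (hy : s.nat yCounter 0 = y)
    (u : Fin n) : (mergeCode.run I s).nat labelArray u =
      if s.nat labelArray u = s.nat labelArray x then s.nat labelArray y
      else s.nat labelArray u := by
  simp [mergeCode, Code.run_seq, run_relabelCode, Code.run_setNat, hx, hy]

theorem run_componentsCode :
    IsLabelling (IsClose I (s.real gammaVar 0) (supp n (s.nat selArray)))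
      (((componentsCode m).run I s).nat labelArray) := by
  rw [componentsCode, Code.run_seq]
  set s₀ := (Code.for_ xCounter .size
    (.setNat labelArray (var xCounter) (var xCounter))).run I s
  have hframe : Frame _ s s₀ := Code.frame _ s
  have hlab (u : Fin n) : s₀.nat labelArray u = u :=
    Code.run_for_pointwise (b := .size) (N := n) (by decide) rfl (fun u _ => u)
      (fun u s' _ hu => by simp [Code.run_setNat, hu]) u
  rw [← hframe.nat selArray rfl, ← hframe.real gammaVar rfl]
  set close := IsClose I (s₀.real gammaVar 0) (supp n (s₀.nat selArray))
  suffices IsLabelling (fun u v => (u, v) ∈ Set.univ ∧ close u v) _ by simpa using this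
  refine Code.run_forPairs_of_invariant (fun s => s.nat labelArray) (fun _ _ => rfl)
    (fun _ _ => rfl) rfl (fun D => IsLabelling fun u v => (u, v) ∈ D ∧ close u v) ?_
    fun D x y s' hs' hx hy h => ?_
  · simpa using IsLabelling.of_forall_eq_self hlab
  · have htests := forall_mem_closeTests (I := I) hx hy
    rw [hs'.nat selArray rfl, hs'.real gammaVar rfl] at htests
    by_cases hclose : close x y
    · have hrel : (fun u v => (u, v) ∈ insert (x, y) D ∧ close u v) =
          fun u v => ((u, v) ∈ D ∧ close u v) ∨ u = x ∧ v = y := by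
        ext u v
        simp only [Set.mem_insert_iff, Prod.mk.injEq]
        grind
      rw [Code.run_guard, if_pos (htests.2 hclose), hrel]
      exact h.insert x y (run_mergeCode hx hy)
    · have hrel : (fun u v => (u, v) ∈ insert (x, y) D ∧ close u v) =
          fun u v => (u, v) ∈ D ∧ close u v := by
        ext u v
        simp only [Set.mem_insert_iff, Prod.mk.injEq]
        grind
      rw [Code.run_guard, if_neg (mt htests.1 hclose), hrel]
      exact h

end

/-! ### The search for transversals -/

/-- Add the current point to the sets in the old table. -/
def extendCode : Code :=
  .for_ weightCounter .pow (
    .guard [.natLe (.get weightArray (var xCounter)) (var weightCounter),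
      .nonzero (.get oldTableArray (.sub (var weightCounter) (.get weightArray (var xCounter))))]
      (.setNat tableArray (var weightCounter) (.add
        (.get oldTableArray (.sub (var weightCounter) (.get weightArray (var xCounter))))
        (.get twoPowArray (var xCounter)))))

def extendByLabelCode : Code :=
  .for_ xCounter .size (
    .guard [.nonzero (.get selArray (var xCounter)),
      .natLe (.get labelArray (var xCounter)) (var labelCounter),
      .natLe (var labelCounter) (.get labelArray (var xCounter))]
      extendCode)

def copyTableCode : Code :=
  .for_ weightCounter .pow
    (.setNat oldTableArray (var weightCounter) (.get tableArray (var weightCounter)))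

def tableCode : Code :=
  .for_ weightCounter .pow (.setNat tableArray (var weightCounter) (.lit 0)) ;;
  .setNat tableArray (.lit 0) (.lit 1) ;;
  .for_ labelCounter .size (copyTableCode ;; extendByLabelCode)

/-- Sets of points are coded by positive numbers so that `0` can stand for the absence of a set. -/
def codeOf {n : ℕ} (T : Finset (Fin n)) : ℕ := 1 + ∑ x ∈ T, 2 ^ (x : ℕ)

/-- The entries of the table are codes of members of `𝒯`: entry `t` is the code of a member of
weight `t` if there is one, and `0` otherwise. -/
structure Represents {n : ℕ} (w : Fin n → ℕ) (P : ℕ) (𝒯 : Set (Finset (Fin n))) (tab : ℕ → ℕ) :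
    Prop where
  exists_mem : ∀ t < P, tab t ≠ 0 → ∃ T ∈ 𝒯, ∑ x ∈ T, w x = t ∧ tab t = codeOf T
  ne_zero : ∀ T ∈ 𝒯, ∑ x ∈ T, w x < P → tab (∑ x ∈ T, w x) ≠ 0

/-- The subsets of `A` that contain at most one point of every label, where only labels less than
`j` and, for the label `j`, only points less than `i` are used. -/
def partialTransversals {n : ℕ} (A : Finset (Fin n)) (lab : ℕ → ℕ) (j i : ℕ) :
    Set (Finset (Fin n)) :=
  {T | T ⊆ A ∧ Set.InjOn (fun x : Fin n => lab x) T ∧ ∀ x ∈ T, lab x < j ∨ lab x = j ∧ x.val < i}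

section
variable {n : ℕ} {w : Fin n → ℕ} {P : ℕ} {𝒯 𝒯₀ : Set (Finset (Fin n))} {tab tab' old : ℕ → ℕ}

theorem Represents.singleton_empty (zero : tab 0 = 1) (h : ∀ t < P, t ≠ 0 → tab t = 0) :
    Represents w P {∅} tab where
  exists_mem t ht htab := by
    obtain rfl : t = 0 := by_contra fun h' => htab (h t ht h')
    exact ⟨∅, rfl, by simp, by simpa [codeOf] using zero⟩
  ne_zero := by simp [zero]

theorem Represents.congr (h : Represents w P 𝒯 tab) (h' : ∀ t < P, tab' t = tab t) :
    Represents w P 𝒯 tab' where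
  exists_mem t ht := by
    rw [h' t ht]
    exact h.exists_mem t ht
  ne_zero T hT hP := by
    rw [h' _ hP]
    exact h.ne_zero T hT hP

theorem Represents.union_insert (h : Represents w P 𝒯 tab) (h₀ : Represents w P 𝒯₀ old)
    {x : Fin n} (hx : ∀ T ∈ 𝒯₀, x ∉ T)
    (h' : ∀ t < P, tab' t =
      if w x ≤ t ∧ old (t - w x) ≠ 0 then old (t - w x) + 2 ^ (x : ℕ) else tab t) :
    Represents w P (𝒯 ∪ insert x '' 𝒯₀) tab' where
  exists_mem t ht htab := by
    rw [h' t ht] at htab ⊢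
    split_ifs at htab ⊢ with hadd
    · obtain ⟨T, hT, hsum, hcode⟩ := h₀.exists_mem (t - w x) (by lia) hadd.2
      refine ⟨insert x T, .inr ⟨T, hT, rfl⟩, ?_, ?_⟩
      · rw [Finset.sum_insert (hx T hT)]
        lia
      · rw [hcode, codeOf, codeOf, Finset.sum_insert (hx T hT)]
        ring
    · obtain ⟨T, hT, hsum⟩ := h.exists_mem t ht htab
      exact ⟨T, .inl hT, hsum⟩
  ne_zero := by
    rintro _ (hT | ⟨T, hT, rfl⟩) hP <;> rw [h' _ hP]
    · split_ifs
      exacts [by positivity, h.ne_zero _ hT hP]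
    · rw [Finset.sum_insert (hx T hT)] at hP ⊢
      rw [Nat.add_sub_cancel_left, if_pos ⟨by lia, h₀.ne_zero T hT (by lia)⟩]
      positivity

variable {A T : Finset (Fin n)} {lab : ℕ → ℕ} {j i : ℕ}

theorem partialTransversals_zero : partialTransversals A lab 0 0 = {∅} := by
  ext T
  simp only [partialTransversals, Set.mem_ofPred_eq, Nat.not_lt_zero, and_false, or_false,
    Set.mem_singleton_iff]
  constructor
  · exact fun h => Finset.eq_empty_of_forall_notMem h.2.2
  · rintro rfl
    simp

theorem partialTransversals_succ_zero :
    partialTransversals A lab (j + 1) 0 = partialTransversals A lab j n := by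
  simp [partialTransversals, le_iff_lt_or_eq]

theorem partialTransversals_size (hlab : ∀ x : Fin n, lab x < n) :
    partialTransversals A lab n 0 = {T | T ⊆ A ∧ Set.InjOn (fun x : Fin n => lab x) T} := by
  simp [partialTransversals, hlab]

theorem partialTransversals_succ_of_not {x : Fin n} (h : ¬(x ∈ A ∧ lab x = j)) :
    partialTransversals A lab j (x + 1) = partialTransversals A lab j x := by
  ext T
  refine and_congr_right fun hTA => and_congr_right fun _ => forall₂_congr fun y hy => ?_
  have hne : lab y = j → y ≠ x := by
    rintro hyj rfl
    exact h ⟨hTA hy, hyj⟩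
  rw [ne_eq, Fin.ext_iff] at hne
  lia

theorem notMem_of_mem_partialTransversals {x : Fin n} (hj : lab x = j)
    (hT : T ∈ partialTransversals A lab j 0) : x ∉ T := by
  intro hx
  have := hT.2.2 x hx
  lia

theorem partialTransversals_succ {x : Fin n} (hx : x ∈ A) (hj : lab x = j) :
    partialTransversals A lab j (x + 1) =
      partialTransversals A lab j x ∪ insert x '' partialTransversals A lab j 0 := by
  ext T
  constructor
  · rintro ⟨hTA, hinj, hlab⟩
    by_cases hxT : x ∈ T
    · refine .inr ⟨T.erase x, ⟨(Finset.erase_subset x T).trans hTA,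
        hinj.mono (Finset.coe_subset.2 (Finset.erase_subset x T)), fun y hy => ?_⟩,
        Finset.insert_erase hxT⟩
      obtain ⟨hne, hyT⟩ := Finset.mem_erase.1 hy
      have hy : lab y ≠ j := fun h => hne (hinj hyT hxT (h.trans hj.symm))
      exact .inl ((hlab y hyT).resolve_right fun h => hy h.1)
    · refine .inl ⟨hTA, hinj, fun y hy => ?_⟩
      have hne : y.val ≠ x := fun h => hxT (Fin.ext h ▸ hy)
      have := hlab y hy
      lia
  · rintro (⟨hTA, hinj, hlab⟩ | ⟨T, hT, rfl⟩)
    · refine ⟨hTA, hinj, fun y hy => ?_⟩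
      have := hlab y hy
      lia
    · have hxT : x ∉ T := notMem_of_mem_partialTransversals hj hT
      obtain ⟨hTA, hinj, hlab⟩ := hT
      refine ⟨Finset.insert_subset hx hTA, ?_, ?_⟩
      · rw [Finset.coe_insert, Set.injOn_insert (by simpa using hxT)]
        refine ⟨hinj, ?_⟩
        rintro ⟨y, hy, hxy⟩
        have := hlab y hy
        dsimp only at hxy
        lia
      · rw [Finset.forall_mem_insert]
        exact ⟨.inr ⟨hj, x.val.lt_succ_self⟩, fun y hy => .inl (by simpa using hlab y hy)⟩

end

/-- The memory holds the data for the search: the set `A` of selected points, their labels, the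
weights, the powers of two and the bound `P` for the weights. -/
structure IsTableInput {n : ℕ} (A : Finset (Fin n)) (lab : ℕ → ℕ) (w : Fin n → ℕ) (P : ℕ)
    (s : Memory) : Prop where
  sel : supp n (s.nat selArray) = A
  label : s.nat labelArray = lab
  weight : ∀ x : Fin n, s.nat weightArray x = w x
  twoPow : ∀ x : Fin n, s.nat twoPowArray x = 2 ^ (x : ℕ)
  pow : s.nat powArray 0 = P

section
variable {m n : ℕ} {I : Instance m n} {A : Finset (Fin n)} {lab : ℕ → ℕ} {w : Fin n → ℕ} {P : ℕ}
  {s : Memory}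

theorem IsTableInput.of_frame (h : IsTableInput A lab w P s) {p : Code} {s' : Memory}
    (hs' : Frame p s s')
    (hp : ∀ a ∈ [selArray, labelArray, weightArray, twoPowArray, powArray], p.writes a = false) :
    IsTableInput A lab w P s' where
  sel := by rw [hs'.nat selArray (hp _ (by simp)), h.sel]
  label := by rw [hs'.nat labelArray (hp _ (by simp)), h.label]
  weight := by
    rw [hs'.nat weightArray (hp _ (by simp))]
    exact h.weight
  twoPow := by
    rw [hs'.nat twoPowArray (hp _ (by simp))]
    exact h.twoPow
  pow := by rw [hs'.nat powArray (hp _ (by simp)), h.pow]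

theorem IsTableInput.eval_pow (h : IsTableInput A lab w P s) : Bound.pow.exp.eval I s = P := by
  simpa [Bound.exp] using h.pow

theorem run_extendCode (hin : IsTableInput A lab w P s) {x : Fin n} (hx : s.nat xCounter 0 = x)
    {t : ℕ} (ht : t < P) :
    (extendCode.run I s).nat tableArray t =
      if w x ≤ t ∧ s.nat oldTableArray (t - w x) ≠ 0
      then s.nat oldTableArray (t - w x) + 2 ^ (x : ℕ) else s.nat tableArray t := by
  refine Code.run_for_pointwise (b := .pow) (N := P) (by decide) hin.eval_pow
    (fun t v => if w x ≤ t ∧ s.nat oldTableArray (t - w x) ≠ 0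
      then s.nat oldTableArray (t - w x) + 2 ^ (x : ℕ) else v)
    (fun t s' hs' ht => ?_) ⟨t, ht⟩
  have hin' := hin.of_frame hs' (by decide)
  rw [Code.run_guard]
  simp only [List.forall_mem_cons, List.not_mem_nil, false_imp_iff, implies_true, and_true,
    Test.holds_natLe, Test.holds_nonzero, NatExp.eval_get, NatExp.eval_sub, NatExp.eval_lit, ht,
    hs'.nat xCounter rfl, hx, hin'.weight, hs'.nat oldTableArray rfl]
  split_ifs with h
  · simp [Code.run_setNat, ht, hs'.nat xCounter rfl, hx, hin'.weight,
      hs'.nat oldTableArray rfl, hin'.twoPow]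
  · simp

theorem run_extendByLabelCode (hin : IsTableInput A lab w P s) {j : ℕ}
    (hj : s.nat labelCounter 0 = j)
    (h : Represents w P (partialTransversals A lab j 0) (s.nat tableArray))
    (hold : Represents w P (partialTransversals A lab j 0) (s.nat oldTableArray)) :
    Represents w P (partialTransversals A lab j n)
      ((extendByLabelCode.run I s).nat tableArray) := by
  refine Code.run_for_nat_of_invariant (b := .size) (N := n) (by decide) rfl
    (fun i => Represents w P (partialTransversals A lab j i)) h fun x s' hs' hx h' => ?_
  have hin' := hin.of_frame hs' (by decide)
  rw [Code.run_guard]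
  simp only [List.forall_mem_cons, List.not_mem_nil, false_imp_iff, implies_true, and_true,
    Test.holds_natLe, Test.holds_nonzero, NatExp.eval_get, NatExp.eval_lit, hx, hin'.label,
    hs'.nat labelCounter rfl, hj, ← le_antisymm_iff, ← mem_supp, hin'.sel]
  split_ifs with hxj
  · rw [partialTransversals_succ hxj.1 hxj.2]
    rw [← hs'.nat oldTableArray rfl] at hold
    exact h'.union_insert hold (fun T => notMem_of_mem_partialTransversals hxj.2)
      fun t => run_extendCode hin' hx
  · rwa [partialTransversals_succ_of_not hxj]

theorem run_copyTableCode (hin : IsTableInput A lab w P s) {t : ℕ} (ht : t < P) :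
    (copyTableCode.run I s).nat oldTableArray t = s.nat tableArray t :=
  Code.run_for_pointwise (b := .pow) (N := P) (by decide) hin.eval_pow
    (fun t _ => s.nat tableArray t)
    (fun t s' hs' ht => by simp [Code.run_setNat, ht, hs'.nat tableArray rfl]) ⟨t, ht⟩

theorem run_tableCode (hin : IsTableInput A lab w P s) (hlab : ∀ x : Fin n, lab x < n) :
    Represents w P {T | T ⊆ A ∧ Set.InjOn (fun x : Fin n => lab x) T}
      ((tableCode.run I s).nat tableArray) := by
  have hcleared (t : ℕ) (ht : t < P) : ((Code.for_ weightCounter .pow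
      (.setNat tableArray (var weightCounter) (.lit 0))).run I s).nat tableArray t = 0 :=
    Code.run_for_pointwise (b := .pow) (N := P) (by decide) hin.eval_pow (fun _ _ => 0)
      (fun t s' _ ht => by simp [Code.run_setNat, ht]) ⟨t, ht⟩
  rw [tableCode, Code.run_seq, Code.run_seq, ← partialTransversals_size hlab]
  refine Code.run_for_nat_of_invariant (b := .size) (N := n) (by decide) rfl
    (fun j => Represents w P (partialTransversals A lab j 0)) ?_ fun j s' hs' hj h => ?_
  · rw [partialTransversals_zero]
    refine .singleton_empty (by simp [Code.run_setNat]) fun t ht hne => ?_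
    simp [Code.run_setNat, hne, hcleared t ht]
  · have hin' : IsTableInput A lab w P s' :=
      ((hin.of_frame (Code.frame _ s) (by decide)).of_frame (Code.frame _ _) (by decide)).of_frame
        hs' (by decide)
    have hcopy := Code.frame (I := I) copyTableCode s'
    rw [Code.run_seq, partialTransversals_succ_zero]
    refine run_extendByLabelCode (hin'.of_frame hcopy (by decide))
      (by rw [hcopy.nat labelCounter rfl, hj]) (by rwa [hcopy.nat tableArray rfl])
      (h.congr fun t ht => run_copyTableCode hin' ht)

end

/-! ### Decoding and feasibility -/

/-- `n - (i + 1)` where `i` is the value of `xCounter`; it runs through the points from the last one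
to the first one. -/
def mirrored : NatExp := .sub .size (.add (var xCounter) (.lit 1))

/-- Split off the highest binary digit of the number in `restVar`. -/
def digitCode : Code :=
  .ite (.natLe (.get twoPowArray mirrored) (var restVar))
    (.setNat outputArray mirrored (.lit 1) ;;
      .setNat restVar (.lit 0) (.sub (var restVar) (.get twoPowArray mirrored)))
    (.setNat outputArray mirrored (.lit 0))

def decodeCode (e : NatExp) : Code :=
  .setNat restVar (.lit 0) (.sub e (.lit 1)) ;; .for_ xCounter .size digitCode

def countCode : Code :=
  .setNat countVar (.lit 0) (.lit 0) ;;
  .for_ xCounter .size (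
    .guard [.nonzero (.get outputArray (var xCounter)),
      .nonzero (.member (var xCounter) (var classCounter))]
      (.setNat countVar (.lit 0) (.add (var countVar) (.lit 1))))

def checkClassCode : Code :=
  countCode ;;
  .guard [.not (.natLe (.quota (var classCounter)) (var countVar))]
    (.setNat flagVar (.lit 0) (.lit 1))

/-- Raises a flag if the set in `outputArray` is not feasible. -/
def checkCode (m : ℕ) : Code :=
  .setNat flagVar (.lit 0) (.lit 0) ;;
  .for_ classCounter (.lit m) checkClassCode

section
variable {n : ℕ} {T : Finset (Fin n)}

theorem sum_two_pow_lt (T : Finset (Fin n)) (k : ℕ) :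
    ∑ x : Fin n with x.val < k, (if x ∈ T then 2 ^ (x : ℕ) else 0) < 2 ^ k := by
  rw [← Finset.sum_filter]
  change ∑ x ∈ _, 2 ^ Fin.valEmbedding x < _
  rw [← Finset.sum_map _ Fin.valEmbedding fun x => 2 ^ x]
  refine Nat.geomSum_lt le_rfl fun k hk => ?_
  obtain ⟨x, hx, rfl⟩ := Finset.mem_map.1 hk
  exact (Finset.mem_filter.1 (Finset.mem_filter.1 hx).1).2

theorem two_pow_le_sum_iff (x : Fin n) :
    2 ^ (x : ℕ) ≤ ∑ y : Fin n with y.val < x.val + 1, (if y ∈ T then 2 ^ (y : ℕ) else 0) ↔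
      x ∈ T := by
  rw [sum_filter_val_lt_succ (fun y => if y ∈ T then 2 ^ (y : ℕ) else 0) x]
  split_ifs with hx
  · simp [hx]
  · simpa only [hx, iff_false, not_le, add_zero] using sum_two_pow_lt T x

variable {m : ℕ} {I : Instance m n} {s : Memory}

@[simp]
theorem eval_mirrored : mirrored.eval I s = n - (s.nat xCounter 0 + 1) := by
  simp [mirrored, NatExp.eval]

theorem run_digitCode {x : Fin n} (hx : s.nat xCounter 0 = x.rev)
    (hpow : s.nat twoPowArray x = 2 ^ (x : ℕ)) :
    ((digitCode.run I s).nat restVar 0, (digitCode.run I s).nat outputArray) =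
      if 2 ^ (x : ℕ) ≤ s.nat restVar 0
      then (s.nat restVar 0 - 2 ^ (x : ℕ), Function.update (s.nat outputArray) x 1)
      else (s.nat restVar 0, Function.update (s.nat outputArray) x 0) := by
  have hrev : n - (x.rev.val + 1) = x := by
    rw [← Fin.val_rev, Fin.rev_rev]
  simp only [digitCode, Code.run, Test.holds_natLe, NatExp.eval_get, NatExp.eval_lit,
    eval_mirrored, hx, hrev, hpow]
  split_ifs <;> simp [hx, hrev, hpow, -Fin.val_rev]

theorem run_decodeCode {e : NatExp} (hpow : ∀ x : Fin n, s.nat twoPowArray x = 2 ^ (x : ℕ))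
    (he : e.eval I s = codeOf T) : supp n (((decodeCode e).run I s).nat outputArray) = T := by
  have h := Code.run_for_of_invariant (I := I) (s := s.setNat restVar 0 (∑ x ∈ T, 2 ^ (x : ℕ)))
    (a := xCounter) (b := .size) (N := n) (p := digitCode)
    (fun s => (s.nat restVar 0, s.nat outputArray)) (fun _ _ => rfl) rfl
    (fun k q => q.1 = ∑ x : Fin n with x.val < n - k, (if x ∈ T then 2 ^ (x : ℕ) else 0) ∧
      ∀ x : Fin n, n - k ≤ x → (q.2 x ≠ 0 ↔ x ∈ T))
    ⟨by simp, fun x hx => absurd x.2 (by lia)⟩ fun i s' hs' hi ⟨hrest, hout⟩ => ?_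
  · ext x
    rw [mem_supp, decodeCode, Code.run_seq, Code.run_setNat, NatExp.eval_sub, he]
    simpa [codeOf] using h.2 x (by simp)
  · obtain ⟨x, rfl⟩ := Fin.rev_surjective i
    have hsucc : n - (x.rev.val + 1) = x ∧ n - x.rev.val = x + 1 := by
      rw [Fin.val_rev]
      lia
    dsimp only at hrest hout
    rw [hsucc.2] at hrest hout
    rw [run_digitCode hi (by rw [hs'.nat twoPowArray rfl]; exact hpow x), hrest,
      if_congr (two_pow_le_sum_iff x) rfl rfl, hsucc.1,
      sum_filter_val_lt_succ (fun y => if y ∈ T then 2 ^ (y : ℕ) else 0) x]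
    have hupdate (b : ℕ) (hb : b ≠ 0 ↔ x ∈ T) (y : Fin n) (hy : x ≤ y) :
        Function.update (s'.nat outputArray) x b y ≠ 0 ↔ y ∈ T := by
      obtain rfl | hlt := hy.eq_or_lt
      · simpa using hb
      · rw [Function.update_of_ne (by simpa [Fin.ext_iff] using hlt.ne')]
        exact hout y hlt
    split_ifs with hx
    · exact ⟨Nat.add_sub_cancel _ _, hupdate 1 (by simpa using hx)⟩
    · exact ⟨rfl, hupdate 0 (by simpa using hx)⟩

theorem run_countCode {i : Fin m} (hi : s.nat classCounter 0 = i) :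
    (countCode.run I s).nat countVar 0 = (supp n (s.nat outputArray) ∩ I.U i).card := by
  rw [countCode, Code.run_seq, Code.run_for_sum (b := .size) (N := n) (by decide) rfl
    (fun x => if x ∈ supp n (s.nat outputArray) ∩ I.U i then 1 else 0) fun x s' hs' hx => ?_]
  · simp [Code.run_setNat, -Finset.mem_inter]
  · have hi' : s'.nat classCounter 0 = i := by rw [hs'.nat classCounter rfl]; exact hi
    have hmem := NatExp.eval_member I s' (e := var xCounter) (f := var classCounter)
      (by simpa using hx) (by simpa using hi')
    have hout : s'.nat outputArray = s.nat outputArray := hs'.nat outputArray rfl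
    rw [Code.run_guard]
    simp only [List.forall_mem_cons, List.not_mem_nil, false_imp_iff, implies_true, and_true,
      Test.holds_nonzero, NatExp.eval_get, NatExp.eval_lit, hx, hmem, hout, ← mem_supp, ne_eq,
      ite_eq_right_iff, one_ne_zero, imp_false, not_not, ← Finset.mem_inter]
    split_ifs <;> simp [Code.run_setNat]

theorem run_checkClassCode {i : Fin m} (hi : s.nat classCounter 0 = i) :
    (checkClassCode.run I s).nat flagVar 0 =
      if I.k i ≤ (supp n (s.nat outputArray) ∩ I.U i).card then s.nat flagVar 0 else 1 := by
  have hcount := Code.frame (I := I) countCode s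
  have hquota := NatExp.eval_quota I (countCode.run I s) (e := var classCounter) (i := i)
    (by rw [NatExp.eval_get, NatExp.eval_lit, hcount.nat classCounter rfl, hi])
  rw [checkClassCode, Code.run_seq, Code.run_guard]
  simp only [List.forall_mem_cons, List.not_mem_nil, false_imp_iff, implies_true, and_true,
    Test.Holds, NatExp.eval_get, NatExp.eval_lit, hquota, run_countCode hi]
  rw [ite_not]
  split_ifs
  · rw [hcount.nat flagVar rfl]
  · simp [Code.run_setNat]

theorem run_checkCode :
    ((checkCode m).run I s).nat flagVar 0 = 0 ↔ Feasible I (supp n (s.nat outputArray)) := by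
  have hclass (i : Fin m) (s' : Memory)
      (hs' : Frame (.for_ classCounter (.lit m) checkClassCode) (s.setNat flagVar 0 0) s')
      (hi : s'.nat classCounter 0 = i) : (checkClassCode.run I s').nat flagVar 0 =
        if I.k i ≤ (supp n (s.nat outputArray) ∩ I.U i).card then s'.nat flagVar 0 else 1 := by
    rw [run_checkClassCode hi, hs'.nat outputArray rfl]
    rfl
  have h := Code.run_for_search (I := I) (k := flagVar) (a := classCounter) (b := .lit m) (N := m)
    (by decide) rfl
    (fun i => ¬ I.k i ≤ (supp n (s.nat outputArray) ∩ I.U i).card) (fun _ => 1)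
    (fun i s' hs' hi hQ => by rw [hclass i s' hs' hi, if_neg hQ])
    (fun i s' hs' hi hQ => by rw [hclass i s' hs' hi, if_pos (not_not.1 hQ)])
  rw [checkCode, Code.run_seq, Code.run_setNat]
  obtain ⟨i, hi, hflag⟩ | ⟨hall, hflag⟩ := h
  · exact iff_of_false (by simp [hflag]) fun h => hi (h i)
  · exact iff_of_true (by simp [hflag]) fun i => not_not.1 (hall i)

end

/-! ### Trying a guess -/

section
variable {m n : ℕ} (I : Instance m n)

/-- The numbers of points of `T` in the classes. -/
def classCounts (T : Finset (Fin n)) (i : Fin m) : Fin (n + 1) :=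
  ⟨(T ∩ I.U i).card, Nat.lt_succ_of_le (by simpa using Finset.card_le_univ (T ∩ I.U i))⟩

theorem sum_weight (T : Finset (Fin n)) :
    ∑ x ∈ T, weight I x = finFunctionFinEquiv (classCounts I T) := by
  simp only [weight, finFunctionFinEquiv_apply, classCounts]
  rw [Finset.sum_comm]
  refine Finset.sum_congr rfl fun i _ => ?_
  rw [← Finset.sum_filter, Finset.sum_const, smul_eq_mul, Finset.filter_mem_eq_inter]

theorem sum_weight_lt (T : Finset (Fin n)) : ∑ x ∈ T, weight I x < (n + 1) ^ m := by
  rw [sum_weight]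
  exact (finFunctionFinEquiv (classCounts I T)).isLt

variable {I}

theorem feasible_of_sum_weight_eq {T T' : Finset (Fin n)}
    (h : ∑ x ∈ T, weight I x = ∑ x ∈ T', weight I x) (hT : Feasible I T) : Feasible I T' := by
  rw [sum_weight, sum_weight, Fin.val_inj, finFunctionFinEquiv.apply_eq_iff_eq] at h
  intro i
  have hi : (T ∩ I.U i).card = (T' ∩ I.U i).card := congrArg Fin.val (congrFun h i)
  exact hi ▸ hT i

end

def checkEntryCode (m : ℕ) : Code :=
  .guard [.nonzero (.get tableArray (var weightCounter))] (
    decodeCode (.get tableArray (var weightCounter)) ;;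
    checkCode m ;;
    .guard [.zero (var flagVar)]
      (.setNat foundVar (.lit 0) (.get tableArray (var weightCounter))))

/-- Look for a feasible set in the table. -/
def searchCode (m : ℕ) : Code :=
  .setNat foundVar (.lit 0) (.lit 0) ;;
  .for_ weightCounter .pow (checkEntryCode m)

/-- Store the set that was found if the current guess is at least the stored one. -/
def recordCode : Code :=
  .guard [.nonzero (var foundVar), .realLe (.get bestVar (.lit 0)) (.get gammaVar (.lit 0))]
    (.setNat bestCodeVar (.lit 0) (var foundVar) ;;
      .setReal bestVar (.lit 0) (.get gammaVar (.lit 0)))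

/-- Look for a feasible result with the guess in `gammaVar`. -/
def findCode (m : ℕ) : Code :=
  selectCode m ;; componentsCode m ;; tableCode ;; searchCode m

def tryCode (m : ℕ) : Code := findCode m ;; recordCode

/-- `T` is a feasible set that the flow phase can return for the guess `γ` and some selection. -/
def IsResult {m n : ℕ} (I : Instance m n) (γ : ℝ) (T : Finset (Fin n)) : Prop :=
  Feasible I T ∧ ∃ Z, IsSelection I γ Z ∧ IsTransversal I γ Z T

/-- The variables and tables that do not depend on the guess have been computed. -/
structure IsPrepared {m n : ℕ} (I : Instance m n) (s : Memory) : Prop where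
  weight_eq : ∀ x : Fin n, s.nat weightArray x = weight I x
  twoPow_eq : ∀ x : Fin n, s.nat twoPowArray x = 2 ^ (x : ℕ)
  pow_eq : s.nat powArray 0 = (n + 1) ^ m

/-- The code and the guess that are stored as the best ones. -/
def stored (s : Memory) : ℕ × ℝ := (s.nat bestCodeVar 0, s.real bestVar 0)

/-- What is known about the stored code and the stored guess after the guesses in `G` have been
tried. No set has been stored as long as the code is `0`. -/
structure IsBest {m n : ℕ} (I : Instance m n) (G : Set ℝ) (q : ℕ × ℝ) : Prop where
  exists_result : q.1 ≠ 0 → ∃ T, IsResult I q.2 T ∧ q.1 = codeOf T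
  eq_zero : q.1 = 0 → q.2 = 0
  le : ∀ γ ∈ G, (γ : EReal) ≤ opt I → q.1 ≠ 0 ∧ γ ≤ q.2

section
variable {m n : ℕ} {I : Instance m n} {A : Finset (Fin n)} {lab : ℕ → ℕ} {w : Fin n → ℕ} {P : ℕ}
  {𝒯 : Set (Finset (Fin n))} {s : Memory}

open Classical in
theorem run_checkEntryCode (hpow : ∀ x : Fin n, s.nat twoPowArray x = 2 ^ (x : ℕ))
    (h : Represents (weight I) P 𝒯 (s.nat tableArray)) {t : ℕ} (ht : s.nat weightCounter 0 = t)
    (htP : t < P) :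
    ((checkEntryCode m).run I s).nat foundVar 0 =
      if ∃ T ∈ 𝒯, ∑ x ∈ T, weight I x = t ∧ Feasible I T then s.nat tableArray t
      else s.nat foundVar 0 := by
  rw [checkEntryCode, Code.run_guard]
  simp only [List.forall_mem_cons, List.not_mem_nil, false_imp_iff, implies_true, and_true,
    Test.holds_nonzero, NatExp.eval_get, NatExp.eval_lit, ht]
  by_cases htab : s.nat tableArray t = 0
  · rw [if_neg (not_not.2 htab), if_neg]
    rintro ⟨T, hT, rfl, -⟩
    exact h.ne_zero T hT htP htab
  · obtain ⟨T, hT, hsum, hcode⟩ := h.exists_mem t htP htab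
    have hiff : (∃ T ∈ 𝒯, ∑ x ∈ T, weight I x = t ∧ Feasible I T) ↔ Feasible I T :=
      ⟨fun ⟨T', _, hsum', hfeas⟩ => feasible_of_sum_weight_eq (hsum'.trans hsum.symm) hfeas,
        fun hfeas => ⟨T, hT, hsum, hfeas⟩⟩
    have hdecode := run_decodeCode (I := I) (e := .get tableArray (var weightCounter)) (T := T)
      hpow (by simp [ht, hcode])
    set s' := (decodeCode (.get tableArray (var weightCounter)) ;; checkCode m).run I s with hs'
    have hflag : s'.nat flagVar 0 = 0 ↔ Feasible I T := by
      rw [hs', Code.run_seq, run_checkCode, hdecode]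
    have hframe : Frame (decodeCode (.get tableArray (var weightCounter)) ;; checkCode m) s s' :=
      Code.frame _ s
    rw [if_pos htab, if_congr (hiff.trans hflag.symm) rfl rfl]
    change ((Code.guard _ _).run I s').nat foundVar 0 = _
    rw [Code.run_guard]
    simp only [List.forall_mem_cons, List.not_mem_nil, false_imp_iff, implies_true, and_true,
      Test.holds_zero, NatExp.eval_get, NatExp.eval_lit]
    split_ifs
    · simp [Code.run_setNat, hframe.nat tableArray rfl, hframe.nat weightCounter rfl, ht]
    · rw [hframe.nat foundVar rfl]

theorem run_searchCode (hin : IsTableInput A lab (weight I) ((n + 1) ^ m) s)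
    (h : Represents (weight I) ((n + 1) ^ m) 𝒯 (s.nat tableArray)) :
    (∃ T ∈ 𝒯, Feasible I T ∧ ((searchCode m).run I s).nat foundVar 0 = codeOf T) ∨
      (∀ T ∈ 𝒯, ¬ Feasible I T) ∧ ((searchCode m).run I s).nat foundVar 0 = 0 := by
  classical
  have hentry (t : Fin ((n + 1) ^ m)) (s' : Memory)
      (hs' : Frame (.for_ weightCounter .pow (checkEntryCode m)) (s.setNat foundVar 0 0) s')
      (ht : s'.nat weightCounter 0 = t) : ((checkEntryCode m).run I s').nat foundVar 0 =
        if ∃ T ∈ 𝒯, ∑ x ∈ T, weight I x = t ∧ Feasible I T then s.nat tableArray t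
        else s'.nat foundVar 0 := by
    have htab : s'.nat tableArray = s.nat tableArray := hs'.nat tableArray rfl
    have hpow : s'.nat twoPowArray = s.nat twoPowArray := hs'.nat twoPowArray rfl
    rw [run_checkEntryCode (by simpa only [hpow] using hin.twoPow) (by rwa [htab]) ht t.2, htab]
  have hsearch := Code.run_for_search (I := I) (k := foundVar) (a := weightCounter) (b := .pow)
    (by decide)
    (hin.of_frame (.setNat s (p := .setNat foundVar (.lit 0) (.lit 0)) rfl) (by decide)).eval_pow
    (fun t => ∃ T ∈ 𝒯, ∑ x ∈ T, weight I x = t ∧ Feasible I T) (fun t => s.nat tableArray t)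
    (fun t s' hs' ht hQ => by rw [hentry t s' hs' ht, if_pos hQ])
    (fun t s' hs' ht hQ => by rw [hentry t s' hs' ht, if_neg hQ])
  rw [searchCode, Code.run_seq, Code.run_setNat]
  obtain ⟨t, ⟨T, hT, hTt, hfeas⟩, hfound⟩ | ⟨hnone, hfound⟩ := hsearch
  · obtain ⟨T', hT', hsum, hcode⟩ := h.exists_mem t t.2 (hTt ▸ h.ne_zero T hT (sum_weight_lt I T))
    exact .inl ⟨T', hT', feasible_of_sum_weight_eq (hTt.trans hsum.symm) hfeas, hfound.trans hcode⟩
  · exact .inr ⟨fun T hT hfeas => hnone ⟨_, sum_weight_lt I T⟩ ⟨T, hT, rfl, hfeas⟩,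
      hfound.trans (by simp)⟩

theorem IsPrepared.of_frame (h : IsPrepared I s) {p : Code} {s' : Memory} (hs' : Frame p s s')
    (hweight : p.writes weightArray = false) (htwoPow : p.writes twoPowArray = false)
    (hpow : p.writes powArray = false) : IsPrepared I s' where
  weight_eq := by
    rw [hs'.nat weightArray hweight]
    exact h.weight_eq
  twoPow_eq := by
    rw [hs'.nat twoPowArray htwoPow]
    exact h.twoPow_eq
  pow_eq := by rw [hs'.nat powArray hpow, h.pow_eq]

theorem IsPrepared.isTableInput (h : IsPrepared I s) :
    IsTableInput (supp n (s.nat selArray)) (s.nat labelArray) (weight I) ((n + 1) ^ m) s :=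
  ⟨rfl, rfl, h.weight_eq, h.twoPow_eq, h.pow_eq⟩

theorem run_findCode (hs : IsPrepared I s) :
    (∃ T, IsResult I (s.real gammaVar 0) T ∧
        ((findCode m).run I s).nat foundVar 0 = codeOf T) ∨
      ¬ (s.real gammaVar 0 : EReal) ≤ opt I ∧ ((findCode m).run I s).nat foundVar 0 = 0 := by
  simp only [findCode, Code.run_seq]
  have hgreedy := run_selectCode (I := I) (s := s)
  set s₁ := (selectCode m).run I s
  have hγ : s₁.real gammaVar = s.real gammaVar := (Code.frame _ s).real gammaVar rfl
  have hsel := hgreedy.isSelection fun _ hx => by simpa using hx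
  have hlab := run_componentsCode (I := I) (s := s₁)
  have hprep : IsPrepared I s₁ := hs.of_frame (Code.frame _ s) rfl rfl rfl
  rw [hγ] at hlab
  set s₂ := (componentsCode m).run I s₁
  have hA : s₂.nat selArray = s₁.nat selArray := (Code.frame _ s₁).nat selArray rfl
  rw [← hA] at hgreedy hsel hlab
  have hprep₂ : IsPrepared I s₂ := hprep.of_frame (Code.frame _ s₁) rfl rfl rfl
  have hin := hprep₂.isTableInput
  have htrans := fun T => isTransversal_iff (T := T)
    (fun x hx => by simpa using hgreedy.subset hx) hlab
  have htable := run_tableCode (I := I) hin hlab.lt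
  rw [← Set.ext htrans] at htable
  obtain ⟨T, hT, hfeas, hfound⟩ | ⟨hnone, hfound⟩ :=
    run_searchCode (hin.of_frame (Code.frame tableCode s₂) (by decide)) htable
  · exact .inl ⟨T, ⟨hfeas, _, hsel, hT⟩, hfound⟩
  · refine .inr ⟨fun hopt => ?_, hfound⟩
    obtain ⟨T, hT, hfeas⟩ := hsel.exists_transversal hopt
    exact hnone T hT hfeas

open Classical in
theorem run_recordCode :
    stored (recordCode.run I s) =
      if s.nat foundVar 0 ≠ 0 ∧ s.real bestVar 0 ≤ s.real gammaVar 0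
      then (s.nat foundVar 0, s.real gammaVar 0) else stored s := by
  rw [recordCode, Code.run_guard]
  simp only [List.forall_mem_cons, List.not_mem_nil, false_imp_iff, implies_true, and_true,
    Test.holds_nonzero, Test.holds_realLe, NatExp.eval_get, RealExp.eval_get, NatExp.eval_lit]
  split_ifs <;> simp [stored, Code.run_seq, Code.run_setNat, Code.run_setReal]

open Classical in
protected theorem IsBest.insert {G : Set ℝ} {q : ℕ × ℝ} (h : IsBest I G q) {γ : ℝ} {v : ℕ}
    (hγ : 0 ≤ γ) (hv : (∃ T, IsResult I γ T ∧ v = codeOf T) ∨ ¬ (γ : EReal) ≤ opt I ∧ v = 0) :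
    IsBest I (insert γ G) (if v ≠ 0 ∧ q.2 ≤ γ then (v, γ) else q) := by
  split_ifs with hbetter
  · refine ⟨fun _ => hv.resolve_right fun hv => hbetter.1 hv.2, fun hv => absurd hv hbetter.1,
      Set.forall_mem_insert.2 ⟨fun _ => ⟨hbetter.1, le_rfl⟩, fun δ hδ hopt => ?_⟩⟩
    exact ⟨hbetter.1, (h.le δ hδ hopt).2.trans hbetter.2⟩
  · refine ⟨h.exists_result, h.eq_zero, Set.forall_mem_insert.2 ⟨fun hopt => ?_, h.le⟩⟩
    obtain ⟨T, -, rfl⟩ := hv.resolve_right fun hv => hv.1 hopt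
    have hlt : γ < q.2 := by simpa [codeOf] using hbetter
    exact ⟨fun hq => (hγ.trans_lt hlt).ne' (h.eq_zero hq), hlt.le⟩

theorem run_tryCode (hs : IsPrepared I s) (hγ : 0 ≤ s.real gammaVar 0) {G : Set ℝ}
    (h : IsBest I G (stored s)) :
    IsBest I (insert (s.real gammaVar 0) G) (stored ((tryCode m).run I s)) := by
  have hframe := Code.frame (I := I) (findCode m) s
  have hstored : stored ((findCode m).run I s) = stored s := by
    rw [stored, hframe.real bestVar rfl, hframe.nat bestCodeVar rfl, stored]
  rw [tryCode, Code.run_seq, run_recordCode, hstored, hframe.real bestVar rfl,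
    hframe.real gammaVar rfl]
  exact h.insert hγ (run_findCode hs)

end

/-! ### The approximation algorithm -/

def tryDistanceCode (m : ℕ) : Code :=
  .setReal gammaVar (.lit 0) (.dist (var gammaXCounter) (var gammaYCounter)) ;; tryCode m

def guessesCode (m : ℕ) : Code :=
  hugeCode m ;; tryCode m ;; .forPairs gammaXCounter gammaYCounter (tryDistanceCode m)

def prepareCode (m : ℕ) : Code := weightsCode m ;; twoPowersCode

def mainCode (m : ℕ) : Code := guessesCode m ;; decodeCode (var bestCodeVar)

/-- Entry `0` of `powArray`, which bounds loops of `mainCode`, is set between the two parts. -/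
def approxProgram (m : ℕ) : Program :=
  .seq (prepareCode m).compile
    (.seq (.setNat powArray (.lit 0) (var powerVar)) (mainCode m).compile)

section
variable {m n : ℕ} {I : Instance m n} {s : Memory}

theorem run_tryDistanceCode (hs : IsPrepared I s) {x y : Fin n}
    (hx : s.nat gammaXCounter 0 = x) (hy : s.nat gammaYCounter 0 = y) {G : Set ℝ}
    (h : IsBest I G (stored s)) :
    IsBest I (insert (I.d x y) G) (stored ((tryDistanceCode m).run I s)) := by
  have hset : IsPrepared I (s.setReal gammaVar 0 (I.d x y)) :=
    ⟨hs.weight_eq, hs.twoPow_eq, hs.pow_eq⟩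
  have hdist := RealExp.eval_dist I s (e := var gammaXCounter) (f := var gammaYCounter)
    (by simpa using hx) (by simpa using hy)
  rw [tryDistanceCode, Code.run_seq, Code.run_setReal, hdist]
  simpa using run_tryCode hset (by simpa using I.d_nonneg x y) h

theorem run_guessesCode (hs : IsPrepared I s) (hstored : stored s = (0, 0)) :
    ∃ H : ℝ, (∀ x y, denominator m * I.d x y < H) ∧
      IsBest I (insert H (Set.range fun q : Fin n × Fin n => I.d q.1 q.2))
        (stored ((guessesCode m).run I s)) := by
  obtain ⟨hpos, hhuge⟩ := run_hugeCode (I := I) (s := s)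
  refine ⟨_, hhuge, ?_⟩
  simp only [guessesCode, Code.run_seq]
  have hprep : IsPrepared I ((hugeCode m).run I s) := hs.of_frame (Code.frame _ s) rfl rfl rfl
  have hprep' := hprep.of_frame (Code.frame (I := I) (tryCode m) _) rfl rfl rfl
  have hempty : IsBest I ∅ (stored ((hugeCode m).run I s)) := by
    have : stored ((hugeCode m).run I s) = stored s := by
      rw [stored, (Code.frame _ s).nat bestCodeVar rfl, (Code.frame _ s).real bestVar rfl, stored]
    rw [this, hstored]
    exact ⟨fun h => absurd rfl h, fun _ => rfl, fun _ h => h.elim⟩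
  have htry := run_tryCode hprep hpos.le hempty
  set H := ((hugeCode m).run I s).real gammaVar 0
  rw [← Set.image_univ]
  refine Code.run_forPairs_of_invariant (a := gammaXCounter) (b := gammaYCounter)
    (p := tryDistanceCode m) stored (fun _ _ => rfl) (fun _ _ => rfl) rfl
    (fun D => IsBest I (insert H ((fun q => I.d q.1 q.2) '' D))) (by simpa using htry)
    fun D x y s' hs' hx hy h => ?_
  rw [Set.image_insert_eq, Set.insert_comm]
  exact run_tryDistanceCode (hprep'.of_frame hs' rfl rfl rfl) hx hy h

end

section
variable {m n : ℕ} {I : Instance m n} {γ : ℝ} {T : Finset (Fin n)}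

theorem opt_eq_top_or_eq_dist (I : Instance m n) :
    opt I = ⊤ ∨ ∃ x y, opt I = (I.d x y : EReal) := by
  classical
  obtain ⟨O, -, hO⟩ := exists_isOptimal I
  rw [← hO]
  obtain h | h := O.offDiag.eq_empty_or_nonempty
  · refine .inl (top_le_iff.1 (le_iInf₂ fun x hx => le_iInf₂ fun y hy => le_iInf fun hxy => ?_))
    exact absurd (h ▸ Finset.mem_offDiag.2 ⟨hx, hy, hxy⟩) (Finset.notMem_empty (x, y))
  · obtain ⟨⟨x, y⟩, hxy, hmin⟩ := O.offDiag.exists_min_image (fun p => I.d p.1 p.2) h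
    obtain ⟨hx, hy, hne⟩ := Finset.mem_offDiag.1 hxy
    refine .inr ⟨x, y, le_antisymm ?_ (le_diversity_iff.2 fun u hu v hv huv =>
      hmin (u, v) (Finset.mem_offDiag.2 ⟨hu, hv, huv⟩))⟩
    exact (iInf₂_le x hx).trans ((iInf₂_le y hy).trans (iInf_le _ hne))

theorem Apart.mul_opt_le_diversity (hT : Apart I (d2 m γ) T) (hγ : opt I = (γ : EReal)) :
    ((1 / (3 * (bigM m : ℝ) - 1) : ℝ) : EReal) * opt I ≤ diversity I T := by
  rw [hγ, ← EReal.coe_mul, one_div_mul_eq_div]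
  exact le_diversity_iff.2 hT

theorem Apart.mono {r r' : ℝ} (hT : Apart I r T) (h : r' ≤ r) : Apart I r' T :=
  fun x hx y hy hxy => h.trans (hT x hx y hy hxy)

theorem Apart.diversity_eq_top (hT : Apart I (d2 m γ) T)
    (hγ : ∀ x y, denominator m * I.d x y < γ) : diversity I T = ⊤ := by
  refine top_le_iff.1 (le_iInf₂ fun x hx => le_iInf₂ fun y hy => le_iInf fun hxy => ?_)
  have hle := hT x hx y hy hxy
  have hlt := hγ x y
  rw [d2, div_le_iff₀ (denominator_pos m), mul_comm, ← cast_denominator] at hle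
  exact absurd hlt hle.not_gt

theorem IsResult.exists_fairPlusFlow (h : IsResult I γ T) (R : EdgeRule) :
    ∃ c, Admissible I c ∧ FairPlusFlow I γ R c (some T) := by
  obtain ⟨hfeas, Z, hZ, hT⟩ := h
  exact hT.exists_fairPlusFlow hZ hfeas R

theorem IsResult.apart (h : IsResult I γ T) : Apart I (d2 m γ) T := by
  obtain ⟨c, -, Z, -, hout⟩ := h.exists_fairPlusFlow .exact
  exact apart_of_outcome hout

theorem IsBest.exists_mul_opt_le_diversity {H : ℝ} {q : ℕ × ℝ}
    (h : IsBest I (insert H (Set.range fun q : Fin n × Fin n => I.d q.1 q.2)) q)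
    (hH : ∀ x y, denominator m * I.d x y < H) :
    ∃ γ T, IsResult I γ T ∧ q.1 = codeOf T ∧
      ((1 / (3 * (bigM m : ℝ) - 1) : ℝ) : EReal) * opt I ≤ diversity I T := by
  obtain htop | ⟨x, y, hxy⟩ := opt_eq_top_or_eq_dist I
  · obtain ⟨hq, hle⟩ := h.le H (.inl rfl) (by simp [htop])
    obtain ⟨T, hT, hcode⟩ := h.exists_result hq
    exact ⟨q.2, T, hT, hcode,
      le_top.trans_eq (hT.apart.diversity_eq_top fun x y => (hH x y).trans_le hle).symm⟩
  · obtain ⟨hq, hle⟩ := h.le (I.d x y) (.inr ⟨(x, y), rfl⟩) hxy.ge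
    obtain ⟨T, hT, hcode⟩ := h.exists_result hq
    have hd2 : d2 m (I.d x y) ≤ d2 m q.2 := div_le_div_of_nonneg_right hle (denominator_pos m).le
    exact ⟨q.2, T, hT, hcode, (hT.apart.mono hd2).mul_opt_le_diversity hxy⟩

end

section
variable {m n : ℕ}

/-- The memory in which `mainCode` is run by `approxProgram`. -/
noncomputable def mainInput (I : Instance m n) : Memory :=
  let s := (prepareCode m).run I Memory.init
  s.setNat powArray 0 (s.nat powerVar 0)

theorem isPrepared_mainInput (I : Instance m n) : IsPrepared I (mainInput I) := by
  obtain ⟨hpow, hweight⟩ := run_weightsCode (I := I) (s := Memory.init) fun _ => rfl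
  set s := (weightsCode m).run I Memory.init with hs
  have hframe := Code.frame (I := I) twoPowersCode s
  refine ⟨fun x => ?_, fun x => ?_, ?_⟩
  · simpa [mainInput, prepareCode, Code.run_seq, ← hs, hframe.nat weightArray rfl] using hweight x
  · simpa [mainInput, prepareCode, Code.run_seq, ← hs]
      using run_twoPowersCode (I := I) (s := s) x x.2.le
  · simpa [mainInput, prepareCode, Code.run_seq, ← hs, hframe.nat powerVar rfl] using hpow

theorem stored_mainInput (I : Instance m n) : stored (mainInput I) = (0, 0) := by
  have hframe := Code.frame (I := I) (prepareCode m) Memory.init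
  exact Prod.ext (congrFun (hframe.nat bestCodeVar rfl) 0) (congrFun (hframe.real bestVar rfl) 0)

theorem countersSafe_prepareCode (m : ℕ) : (prepareCode m).countersSafe = true := rfl

theorem countersSafe_mainCode (m : ℕ) : (mainCode m).countersSafe = true := rfl

theorem exists_computes_approxProgram (m : ℕ) :
    ∃ q : Polynomial ℕ, ∀ (n : ℕ) (I : Instance m n), ∃ γ T, IsResult I γ T ∧
      Computes I (approxProgram m) (q.eval n) T ∧
      ((1 / (3 * (bigM m : ℝ) - 1) : ℝ) : EReal) * opt I ≤ diversity I T := by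
  refine ⟨(prepareCode m).timeBound m + (4 + (mainCode m).timeBound m), fun n I => ?_⟩
  obtain ⟨t₁, ht₁, hexec₁⟩ := Code.exists_exec (I := I) (countersSafe_prepareCode m) rfl
    (s := Memory.init) (by simp [Memory.init])
  have hexec₂ : Exec I _ _ 4 (mainInput I) := Exec.setNat _ powArray (.lit 0) (var powerVar)
  have hprep := isPrepared_mainInput I
  obtain ⟨t₃, ht₃, hexec₃⟩ := Code.exists_exec (countersSafe_mainCode m) rfl hprep.pow_eq.le
  obtain ⟨H, hH, hbest⟩ := run_guessesCode hprep (stored_mainInput I)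
  obtain ⟨γ, T, hT, hcode, hdiv⟩ := hbest.exists_mul_opt_le_diversity hH
  have hframe := Code.frame (I := I) (guessesCode m) (mainInput I)
  have hdecode : output n ((mainCode m).run I (mainInput I)) = T :=
    run_decodeCode (e := var bestCodeVar)
      (by simpa [hframe.nat twoPowArray rfl] using hprep.twoPow_eq) (by simpa [stored] using hcode)
  refine ⟨γ, T, hT, ⟨_, _, Exec.seq hexec₁ (Exec.seq hexec₂ hexec₃), ?_, hdecode⟩, hdiv⟩
  simp only [Polynomial.eval_add, Polynomial.eval_ofNat]
  lia

end

end FairDiv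

open FairDiv in
theorem mainTheorem5 (m : ℕ) (R : EdgeRule) :
    -- guarantees for Fair⁺-Flow on every instance and for every guess `γ`
    (∀ (n : ℕ) (I : Instance m n) (γ : ℝ),
      -- the algorithm always produces a result
      (∀ c : Colour m → ℕ, ∃ r, FairPlusFlow I γ R c r) ∧
      -- whatever `γ` is, it aborts or returns a feasible set of points that are far apart
      (∀ c : Colour m → ℕ, Admissible I c → ∀ r, FairPlusFlow I γ R c r →
        r = none ∨
          ∃ S, r = some S ∧ Feasible I S ∧ Apart I (γ / (3 * (bigM m : ℝ) - 1)) S) ∧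
      -- if `γ` is at most the optimum, it returns such a set for a correct guess of the counts
      ((γ : EReal) ≤ opt I →
        (R = EdgeRule.atLeast → ∀ O, IsOptimal I O →
          ∀ r, FairPlusFlow I γ R (counts I O) r →
            ∃ S, r = some S ∧ Feasible I S ∧ Apart I (γ / (3 * (bigM m : ℝ) - 1)) S) ∧
        (∀ Z, IsSelection I γ Z → ∃ c : Colour m → ℕ, Admissible I c ∧
          ∀ r, Outcome I γ R c Z r →
            ∃ S, r = some S ∧ Feasible I S ∧ Apart I (γ / (3 * (bigM m : ℝ) - 1)) S))) ∧
    -- polynomial-time approximation by Fair⁺-Flow with suitable guesses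
    (∃ (p : Program) (q : Polynomial ℕ), ∀ (n : ℕ) (I : Instance m n),
      ∃ S, Computes I p (q.eval n) S ∧
        (∃ (γ : ℝ) (c : Colour m → ℕ), Admissible I c ∧ FairPlusFlow I γ R c (some S)) ∧
        Feasible I S ∧
        ((1 / (3 * (bigM m : ℝ) - 1) : ℝ) : EReal) * opt I ≤ diversity I S) := by
  refine ⟨fun n I γ => ⟨fun c => ?_, fun c hc r hr => ?_, fun hγ => ⟨?_, fun Z hZ => ?_⟩⟩, ?_⟩
  · obtain ⟨Z, hZ⟩ := exists_isSelection I γ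
    obtain ⟨r, hr⟩ := exists_outcome hZ R c
    exact ⟨r, Z, hZ, hr⟩
  · obtain ⟨Z, -, hout⟩ := hr
    cases r with
    | none => exact .inl rfl
    | some S => exact .inr ⟨S, rfl, feasible_of_outcome hc hout, apart_of_outcome hout⟩
  · rintro rfl O hO r hr
    exact hO.returns hγ hr
  · exact exists_admissible_returns R hγ hZ
  · obtain ⟨q, hq⟩ := exists_computes_approxProgram m
    refine ⟨approxProgram m, q, fun n I => ?_⟩
    obtain ⟨γ, T, hT, hcomp, hdiv⟩ := hq n I
    exact ⟨T, hcomp, ⟨γ, hT.exists_fairPlusFlow R⟩, hT.1, hdiv⟩
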